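/- Let $I$ be a finite set, $\emptyset\neq J\subset I$, let $\omega:\mathbb R^I\to\mathbb R^I$ be a nonsingular linear map, let $\gamma_j>0$ for $j\in J$, and let $\iota_j=\delta_j\langle\delta_j,\cdot\rangle:\mathbb R^J\to\mathbb R^I$, where $\delta_j$ denotes the standard basis vector (of $\mathbb R^J$ or $\mathbb R^I$). Let $U:\mathbb R^I\to\mathbb R$ be differentiable and assume: (K) the pair $(A_0,B_0)=(\omega^*\omega,\sum_{j\in J}\iota_j\iota_j^*)$ satisfies the Kalman condition: every $x\in\mathbb R^I$ is of the form $x=B_0y_0+A_0B_0y_1+\dots+A_0^{|I|-1}B_0y_{|I|-1}$ with $y_0,\dots,y_{|I|-1}\in\mathbb R^I$; (G) $\nabla U$ is $C^\infty$, globally Lipschitz, and $|\nabla U(q)|=o\big(1+|q|^{1/(4|I|)}\big)$ as $|q|\to\infty$; (pH) there is a sequence $(q^{(n)})$ in $\mathbb R^I$, bounded away from $0$, such that $\lim_{n\to\infty}|q^{(n)}|^k\,\|D^{k+1}U(q^{(n)})\|=0$ for each $k=0,1,\dots,|I|-1$. On $\mathbb R^I\oplus\mathbb R^I$, with variable $y=(p,\omega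 q)$, consider the control system $\dot y=f(y)+B\zeta_t$ with $$f(p,\omega q)=\Big(-\sum_{j\in J}\gamma_j\iota_j\iota_j^*\,p-\omega^*\omega q-\nabla U(q),\ \omega p\Big),\qquad B\zeta=\Big(\sum_{j\in J}\iota_j\zeta,\,0\Big),\quad \zeta\in\mathbb R^J .$$ Then for every $T>0$, every initial condition $x$ and every $\zeta\in C([0,T];\mathbb R^J)$ the system has exactly one solution on $[0,T]$; write $S_T(x,\zeta)$ for its value at time $T$. Moreover: (C1) there are a scalar product $\langle\cdot,\cdot\rangle_*$ on $\mathbb R^I\oplus\mathbb R^I$, with norm $\|\cdot\|_*$, and numbers $\alpha,\beta>0$ such that $\langle f(y),y\rangle_*\le-\alpha\|y\|_*^2+\beta$ for all $y$; and there is a point $\hat x\in\mathbb R^I\oplus\mathbb R^I$ such that, $\|\cdot\|$ being the Euclidean norm, (C2) for all $\epsilon>0$ and $R>0$ there is $T>0$ such that for every $x$ with $\|x\|\le R$ there is $\zeta\in C([0,T];\mathbb R^J)$ with $\|S_T(x,\zeta)-\hat x\|<\epsilon$; (C3) there are $\epsilon_0>0$, $T_0>0$, a compact set $\mathcal K\subset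 C([0,T_0];\mathbb R^J)$ (uniform topology) and a closed ball $G\subset\mathbb R^I\oplus\mathbb R^I$ of positive radius such that every continuous $\Phi:\mathcal K\to\mathbb R^I\oplus\mathbb R^I$ with $\sup_{\zeta\in\mathcal K}\|\Phi(\zeta)-S_{T_0}(\hat x,\zeta)\|\le\epsilon_0$ satisfies $G\subset\Phi(\mathcal K)$. -/

import Mathlib

open scoped NNReal

noncomputable section

namespace ControlSystem

variable {E F : Type*} [NormedAddCommGroup E] [NormedSpace ℝ E]
  [NormedAddCommGroup F] [NormedSpace ℝ F]

/-- `X` solves `X' = f X + B ζ` on `[0, T]` with `X 0 = x` (one-sided derivatives at the two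
ends); the control `ζ` is a continuous function on `[0, T]`. -/
def IsTrajectory (f : E → E) (B : F →L[ℝ] E) (T : ℝ) (x : E) (ζ : C(Set.Icc (0 : ℝ) T, F))
    (X : ℝ → E) : Prop :=
  X 0 = x ∧ ∀ t : Set.Icc (0 : ℝ) T,
    HasDerivWithinAt X (f (X t) + B (ζ t)) (Set.Icc 0 T) t

/-- For every horizon, initial condition and continuous control there is exactly one trajectory. -/
def WellPosed (f : E → E) (B : F →L[ℝ] E) : Prop :=
  ∀ T : ℝ, 0 < T → ∀ (x : E) (ζ : C(Set.Icc (0 : ℝ) T, F)),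
    (∃ X : ℝ → E, IsTrajectory f B T x ζ X) ∧
      ∀ X Y : ℝ → E, IsTrajectory f B T x ζ X → IsTrajectory f B T x ζ Y →
        Set.EqOn X Y (Set.Icc 0 T)

open Classical in
/-- The map `S_T (x, ζ) = X_T`, where `X` is the trajectory from `x` under the control `ζ`.
It is meaningful for a well-posed system (the default value `0` is then never used). -/
def S (f : E → E) (B : F →L[ℝ] E) (T : ℝ) (x : E) (ζ : C(Set.Icc (0 : ℝ) T, F)) : E :=
  if h : ∃ X : ℝ → E, IsTrajectory f B T x ζ X then h.choose T else 0

/-- A scalar product on a real vector space: a symmetric positive definite bilinear form. -/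
structure IsScalarProduct (b : LinearMap.BilinForm ℝ E) : Prop where
  symm : ∀ x y : E, b x y = b y x
  pos : ∀ x : E, x ≠ 0 → 0 < b x x

/-- Dissipativity (C1) for the scalar product `b`, whose squared norm is `b y y`. -/
def Dissipative (b : LinearMap.BilinForm ℝ E) (f : E → E) : Prop :=
  ∃ α β : ℝ, 0 < α ∧ 0 < β ∧ ∀ y : E, b (f y) y ≤ -α * b y y + β

/-- Approximate controllability to the point `xhat` (C2). -/
def ApproxControllableTo (f : E → E) (B : F →L[ℝ] E) (xhat : E) : Prop :=
  ∀ ε R : ℝ, 0 < ε → 0 < R → ∃ T : ℝ, 0 < T ∧ ∀ x : E, ‖x‖ ≤ R →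
    ∃ ζ : C(Set.Icc (0 : ℝ) T, F), ‖S f B T x ζ - xhat‖ < ε

/-- Solid controllability from the point `xhat` (C3); the space of controls carries the
topology of uniform convergence. -/
def SolidlyControllableFrom (f : E → E) (B : F →L[ℝ] E) (xhat : E) : Prop :=
  ∃ ε₀ T₀ : ℝ, 0 < ε₀ ∧ 0 < T₀ ∧ ∃ K : Set C(Set.Icc (0 : ℝ) T₀, F), IsCompact K ∧
    ∃ (c : E) (r : ℝ), 0 < r ∧ ∀ Φ : K → E, Continuous Φ →
      (∀ ζ : K, ‖Φ ζ - S f B T₀ xhat ζ‖ ≤ ε₀) → Metric.closedBall c r ⊆ Set.range Φ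

/-- The Kalman condition on the pair `(A, B)`: with `d = dim E`, every `x` can be written as
`B y₀ + A B y₁ + ⋯ + A ^ (d - 1) B y_{d - 1}`. -/
def Kalman (A : E →L[ℝ] E) (B : F →L[ℝ] E) : Prop :=
  ∀ x : E, ∃ y : Fin (Module.finrank ℝ E) → F, x = ∑ k : Fin (Module.finrank ℝ E), (A ^ (k : ℕ)) (B (y k))

end ControlSystem

namespace Network

/-- The space of positions (or of momenta), `ℝ^I` with its Euclidean structure. -/
abbrev Conf (I : Type*) [Fintype I] : Type _ := EuclideanSpace ℝ I

/-- The phase space `ℝ^I ⊕ ℝ^I` with its Euclidean structure; its points are `(p, ω q)`. -/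
abbrev Phase (I : Type*) [Fintype I] : Type _ := WithLp 2 (Conf I × Conf I)

variable {I : Type*} [Fintype I] [DecidableEq I]

/-- The rank-one map `ι_j = δ_j ⟨δ_j, ·⟩ : ℝ^J → ℝ^I`. -/
def iota (J : Finset I) (j : J) : Conf J →L[ℝ] Conf I :=
  (innerSL ℝ (EuclideanSpace.single j (1 : ℝ))).smulRight (EuclideanSpace.single (j : I) (1 : ℝ))

/-- The map `∑_j ι_j ι_j^*` on `ℝ^I`. -/
def bath (J : Finset I) : Conf I →L[ℝ] Conf I :=
  ∑ j : J, iota J j ∘L ContinuousLinearMap.adjoint (iota J j)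

/-- The friction `∑_j γ_j ι_j ι_j^*` on `ℝ^I`. -/
def friction (J : Finset I) (γ : J → ℝ) : Conf I →L[ℝ] Conf I :=
  ∑ j : J, γ j • (iota J j ∘L ContinuousLinearMap.adjoint (iota J j))

/-- The drift `(p, ω q) ↦ (- ∑_j γ_j ι_j ι_j^* p - ω^* (ω q) - ∇U(q), ω p)`. -/
def drift (J : Finset I) (γ : J → ℝ) (ω : Conf I ≃L[ℝ] Conf I) (U : Conf I → ℝ)
    (y : Phase I) : Phase I :=
  WithLp.toLp 2
    (-(friction J γ y.fst) - ContinuousLinearMap.adjoint (ω : Conf I →L[ℝ] Conf I) y.snd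
        - gradient U (ω.symm y.snd),
      ω y.fst)

/-- The control operator `∑_j (ι_j, 0) : ℝ^J → ℝ^I ⊕ ℝ^I`. -/
def controlOp (J : Finset I) : Conf J →L[ℝ] Phase I :=
  ((WithLp.prodContinuousLinearEquiv 2 ℝ (Conf I) (Conf I)).symm :
      (Conf I × Conf I) →L[ℝ] Phase I) ∘L
    (ContinuousLinearMap.inl ℝ (Conf I) (Conf I) ∘L ∑ j : J, iota J j)

/-- (K): the pair `(ω^* ω, ∑_j ι_j ι_j^*)` satisfies the Kalman condition. -/
def CondK (J : Finset I) (ω : Conf I ≃L[ℝ] Conf I) : Prop :=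
  ControlSystem.Kalman
    (ContinuousLinearMap.adjoint (ω : Conf I →L[ℝ] Conf I) ∘L (ω : Conf I →L[ℝ] Conf I)) (bath J)

end Network

namespace Network

variable {I : Type*} [Fintype I]

open scoped ContDiff in
/-- (G): the gradient of `U` is smooth, globally Lipschitz, and is
`o(1 + |q| ^ (1 / (4 |I|)))` as `|q| → ∞`. -/
structure CondG (U : Conf I → ℝ) : Prop where
  differentiable : Differentiable ℝ U
  smooth : ContDiff ℝ ∞ (gradient U)
  lipschitz : ∃ L : ℝ≥0, LipschitzWith L (gradient U)
  growth : Asymptotics.IsLittleO (Bornology.cobounded (Conf I)) (gradient U)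
    (fun q : Conf I => 1 + ‖q‖ ^ ((1 : ℝ) / (4 * (Fintype.card I : ℝ))))

/-- (pH): along some sequence of points bounded away from `0`, `|q| ^ k ‖D^{k+1} U(q)‖ → 0` for
all `k = 0, …, |I| - 1`, where `|I|` is the dimension of the domain of `U`. -/
def CondPH (U : Conf I → ℝ) : Prop :=
  ∃ q : ℕ → Conf I, (∃ r : ℝ, 0 < r ∧ ∀ n, r ≤ ‖q n‖) ∧
    ∀ k : ℕ, k < Fintype.card I →
      Filter.Tendsto (fun n => ‖q n‖ ^ k * ‖iteratedFDeriv ℝ (k + 1) U (q n)‖)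
        Filter.atTop (nhds 0)

end Network

end

/-! Write `f = A + g` with `A` the linear map `linDrift` and `g(y) = (-∇U(q), 0)`. By (G), `g` is
Lipschitz and sublinear: for every `δ > 0` there is `C` with `‖g y‖ ≤ δ‖y‖ + C`. So `f` is
Lipschitz, which gives well-posedness, and everything else is a property of `A` robust under
sublinear perturbations.

That property is observability of the momenta on `J` (`observable_linDrift`). On the unobservable
subspace friction vanishes, so `A²` acts on momenta as `-ω^*ω`; the Kalman condition then forces `p
= 0`, hence `ω^* s = 0` and `s = 0`. The adjoint of `A` is the same map with `-ω` for `ω`, so the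
dual pair is observable too and the linear system is controllable.

Dissipativity: `⟨A y, y⟩` is controlled by the observed momenta only. Observability allows a
correction by cross terms of successive outputs that gives a strict Lyapunov form
(`exists_lyapunov_form`), and its strict decay absorbs `g`.

Controllability: let `R z` be a control, linear in `z`, steering the linear system from `0` to `z`.
By Grönwall, `S_T(x, R z)` differs from `z` by at most `‖z‖/2 + C(1 + ‖x‖)`
(`exists_steering_error_le`). Brouwer's theorem shows that such a continuous map hits every target
(`exists_eq_of_error_le`), and still covers a ball after a bounded continuous perturbation.

Brouwer's theorem comes from the change of variables formula: for `x ↦ x + t h(x)` it holds at small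
`t`, is polynomial in `t`, and so holds at `t = 1`. -/

noncomputable section

/-! ### Radial retraction onto a ball -/

section RadialRetraction

variable {E : Type*} [NormedAddCommGroup E] [NormedSpace ℝ E]

/-- The radial retraction of a normed space onto the closed ball of radius `R` about `0`. -/
def radialRetraction (R : ℝ) (x : E) : E := (R / max R ‖x‖) • x

theorem radialRetraction_of_norm_le {R : ℝ} (hR : 0 < R) {x : E} (hx : ‖x‖ ≤ R) :
    radialRetraction R x = x := by
  rw [radialRetraction, max_eq_left hx, div_self hR.ne', one_smul]

theorem norm_radialRetraction_le {R : ℝ} (hR : 0 < R) (x : E) : ‖radialRetraction R x‖ ≤ R := by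
  have h : 0 < max R ‖x‖ := lt_max_of_lt_left hR
  rw [radialRetraction, norm_smul, Real.norm_of_nonneg (by positivity), div_mul_eq_mul_div,
    div_le_iff₀ h]
  exact mul_le_mul_of_nonneg_left (le_max_right _ _) hR.le

theorem norm_radialRetraction_le_norm {R : ℝ} (hR : 0 < R) (x : E) :
    ‖radialRetraction R x‖ ≤ ‖x‖ := by
  have h : 0 < max R ‖x‖ := lt_max_of_lt_left hR
  rw [radialRetraction, norm_smul, Real.norm_of_nonneg (by positivity)]
  exact mul_le_of_le_one_left (norm_nonneg _) ((div_le_one h).2 (le_max_left _ _))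

/-- In a general normed space the constant is `2`: moving the point and changing the scaling factor
each cost at most `‖x - y‖`. -/
theorem lipschitzWith_radialRetraction {R : ℝ} (hR : 0 < R) :
    LipschitzWith 2 (radialRetraction R : E → E) := by
  refine LipschitzWith.of_dist_le_mul fun x y => ?_
  rw [dist_eq_norm, dist_eq_norm]
  have ha : 0 < max R ‖x‖ := lt_max_of_lt_left hR
  have hb : 0 < max R ‖y‖ := lt_max_of_lt_left hR
  have hab : |max R ‖y‖ - max R ‖x‖| ≤ ‖x - y‖ := by
    have h1 : |max R ‖y‖ - max R ‖x‖| ≤ |‖y‖ - ‖x‖| := by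
      rw [max_comm R, max_comm R]; exact abs_max_sub_max_le_abs _ _ _
    exact h1.trans (by rw [norm_sub_rev]; exact abs_norm_sub_norm_le y x)
  set a := max R ‖x‖
  set b := max R ‖y‖
  have key : radialRetraction R x - radialRetraction R y
      = (R / b) • (x - y) + ((R / b) * ((b - a) / a)) • x := by
    have : R / a = R / b + (R / b) * ((b - a) / a) := by field_simp; ring
    change (R / a) • x - (R / b) • y = _
    rw [this]; module
  have hRb : R / b ≤ 1 := (div_le_one hb).2 (le_max_left _ _)
  have hRb0 : 0 ≤ R / b := by positivity
  rw [key]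
  have h2 : ‖((R / b) * ((b - a) / a)) • x‖ ≤ ‖x - y‖ := by
    rw [norm_smul, norm_mul, norm_div (b - a), Real.norm_of_nonneg hRb0, Real.norm_eq_abs,
      Real.norm_of_nonneg ha.le, mul_assoc]
    refine (mul_le_of_le_one_left (by positivity) hRb).trans ?_
    rw [div_mul_eq_mul_div, div_le_iff₀ ha]
    exact mul_le_mul hab (le_max_right _ _) (norm_nonneg _) (norm_nonneg _)
  have h1 : ‖(R / b) • (x - y)‖ ≤ ‖x - y‖ := by
    rw [norm_smul, Real.norm_of_nonneg hRb0]
    exact mul_le_of_le_one_left (norm_nonneg _) hRb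
  refine (norm_add_le _ _).trans ?_
  norm_num
  linarith

end RadialRetraction

/-! ### Trajectories of Lipschitz control systems -/

theorem gronwallBound_nonneg {δ K ε t : ℝ} (hδ : 0 ≤ δ) (hK : 0 ≤ K) (hε : 0 ≤ ε) (ht : 0 ≤ t) :
    0 ≤ gronwallBound δ K ε t :=
  hδ.trans ((gronwallBound_x0 δ K ε).symm.le.trans (gronwallBound_mono hδ hε hK ht))

namespace ControlSystem

variable {E F : Type*} [NormedAddCommGroup E] [NormedSpace ℝ E]
  [NormedAddCommGroup F] [NormedSpace ℝ F]

/-- Grönwall's inequality for two-sided derivatives within `[0, T]`. -/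
theorem norm_le_gronwallBound {X X' : ℝ → E} {T δ K ε : ℝ} (h0 : ‖X 0‖ ≤ δ)
    (hX : ∀ t ∈ Set.Icc 0 T, HasDerivWithinAt X (X' t) (Set.Icc 0 T) t)
    (hb : ∀ t ∈ Set.Icc 0 T, ‖X' t‖ ≤ K * ‖X t‖ + ε) :
    ∀ t ∈ Set.Icc 0 T, ‖X t‖ ≤ gronwallBound δ K ε t := by
  intro t ht
  have := norm_le_gronwallBound_of_norm_deriv_right_le (f := X) (f' := X') (a := 0) (b := T)
    (fun t ht => (hX t ht).continuousWithinAt)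
    (fun t ht => (hX t ⟨ht.1, ht.2.le⟩).mono_of_mem_nhdsWithin
      (Filter.mem_of_superset (Icc_mem_nhdsGE ht.2) (Set.Icc_subset_Icc_left ht.1)))
    h0 (fun t ht => hb t ⟨ht.1, ht.2.le⟩) t ht
  simpa using this

variable {f : E → E} {B : F →L[ℝ] E} {T : ℝ}

theorem IsTrajectory.hasDerivWithinAt {x : E} {ζ : C(Set.Icc (0 : ℝ) T, F)} {X : ℝ → E}
    (h : IsTrajectory f B T x ζ X) {t : ℝ} (ht : t ∈ Set.Icc 0 T) :
    HasDerivWithinAt X (f (X t) + B (ζ ⟨t, ht⟩)) (Set.Icc 0 T) t := h.2 ⟨t, ht⟩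

/-- Trajectories of a Lipschitz system depend in a Lipschitz way on the initial condition and
on the control. -/
theorem IsTrajectory.norm_sub_le {K : ℝ≥0} (hf : LipschitzWith K f) {x y : E}
    {ζ ξ : C(Set.Icc (0 : ℝ) T, F)} {X Y : ℝ → E}
    (hX : IsTrajectory f B T x ζ X) (hY : IsTrajectory f B T y ξ Y) {t : ℝ}
    (ht : t ∈ Set.Icc 0 T) :
    ‖X t - Y t‖ ≤ gronwallBound ‖x - y‖ K (‖B‖ * ‖ζ - ξ‖) t := by
  let Z' : ℝ → E := fun t => if h : t ∈ Set.Icc 0 T then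
    (f (X t) + B (ζ ⟨t, h⟩)) - (f (Y t) + B (ξ ⟨t, h⟩)) else 0
  refine norm_le_gronwallBound (X := fun t => X t - Y t) (X' := Z') ?_ ?_ ?_ t ht
  · simp [hX.1, hY.1]
  · intro t ht
    simp only [Z', dif_pos ht]
    exact (hX.hasDerivWithinAt ht).sub (hY.hasDerivWithinAt ht)
  · intro t ht
    simp only [Z', dif_pos ht]
    have h1 : ‖f (X t) - f (Y t)‖ ≤ K * ‖X t - Y t‖ := by
      simpa [dist_eq_norm] using hf.dist_le_mul (X t) (Y t)
    have h2 : ‖B (ζ ⟨t, ht⟩) - B (ξ ⟨t, ht⟩)‖ ≤ ‖B‖ * ‖ζ - ξ‖ := by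
      rw [← map_sub]
      refine (B.le_opNorm _).trans ?_
      gcongr
      exact (ζ - ξ).norm_coe_le_norm ⟨t, ht⟩
    rw [add_sub_add_comm]
    exact (norm_add_le _ _).trans (add_le_add h1 h2)

/-- Composing `f` with a retraction bounds the field, so Picard–Lindelöf applies on all of `[0, T]`
at once; the a priori Grönwall bound keeps the solution where the retraction is the identity. -/
theorem exists_isTrajectory [CompleteSpace E] {K : ℝ≥0} (hf : LipschitzWith K f) (hT : 0 < T)
    (x : E) (ζ : C(Set.Icc (0 : ℝ) T, F)) : ∃ X, IsTrajectory f B T x ζ X := by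
  set c : ℝ := ‖f 0‖ + ‖B‖ * ‖ζ‖ with hc
  have hc0 : 0 ≤ c := by positivity
  set R : ℝ := gronwallBound ‖x‖ K c T + 1
  have hR : 0 < R := by
    have := gronwallBound_nonneg (norm_nonneg x) K.2 hc0 hT.le
    positivity
  let u : ℝ → F := fun t => ζ (Set.projIcc 0 T hT.le t)
  have hu : Continuous u := ζ.continuous.comp continuous_projIcc
  let v : ℝ → E → E := fun t y => f (radialRetraction R y) + B (u t)
  have hub : ∀ t, ‖B (u t)‖ ≤ ‖B‖ * ‖ζ‖ := fun t =>
    (B.le_opNorm _).trans (by gcongr; exact ζ.norm_coe_le_norm _)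
  have hfb : ∀ y, ‖f y‖ ≤ ‖f 0‖ + K * ‖y‖ := fun y => by
    have := hf.dist_le_mul y 0
    rw [dist_eq_norm, dist_zero_right] at this
    linarith [norm_le_norm_add_norm_sub' (f y) (f 0)]
  have hvb : ∀ t y, ‖v t y‖ ≤ K * ‖radialRetraction R y‖ + c := fun t y => by
    refine (norm_add_le _ _).trans ?_
    linarith [hub t, hfb (radialRetraction R y)]
  let L : ℝ≥0 := ⟨K * R + c, by positivity⟩
  have hPL : IsPicardLindelof v (⟨0, le_rfl, hT.le⟩ : Set.Icc (0 : ℝ) T) x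
      (L * ⟨T, hT.le⟩) 0 L (K * 2) := by
    refine ⟨fun t _ => ?_, fun y _ => ?_, fun t _ y _ => ?_, ?_⟩
    · refine LipschitzWith.lipschitzOnWith ?_
      have := hf.comp (lipschitzWith_radialRetraction (E := E) hR)
      refine LipschitzWith.of_dist_le_mul fun a b => ?_
      simpa [v] using this.dist_le_mul a b
    · exact (continuous_const.add (B.continuous.comp hu)).continuousOn
    · refine (hvb t y).trans ?_
      change _ ≤ K * R + c
      gcongr
      exact norm_radialRetraction_le hR y
    · simp only [sub_zero, sub_self, max_eq_left hT.le, NNReal.coe_zero]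
      exact le_rfl
  obtain ⟨X, hX0, hX⟩ := hPL.exists_eq_forall_mem_Icc_hasDerivWithinAt₀
  have hbound : ∀ t ∈ Set.Icc 0 T, ‖X t‖ ≤ R := by
    intro t ht
    have h := norm_le_gronwallBound (X := X) (X' := fun t => v t (X t)) (T := T) (δ := ‖x‖)
      (K := K) (ε := c) (by rw [hX0]) hX (fun t _ => (hvb t (X t)).trans (by
        gcongr; exact norm_radialRetraction_le_norm hR _)) t ht
    exact (h.trans (gronwallBound_mono (norm_nonneg x) hc0 K.2 ht.2)).trans
      (le_add_of_nonneg_right zero_le_one)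
  refine ⟨X, hX0, fun t => ?_⟩
  have h := hX t t.2
  simpa [v, u, radialRetraction_of_norm_le hR (hbound t t.2)] using h

theorem IsTrajectory.eqOn {K : ℝ≥0} (hf : LipschitzWith K f) {x : E}
    {ζ : C(Set.Icc (0 : ℝ) T, F)} {X Y : ℝ → E}
    (hX : IsTrajectory f B T x ζ X) (hY : IsTrajectory f B T x ζ Y) :
    Set.EqOn X Y (Set.Icc 0 T) := fun t ht => by
  have := hX.norm_sub_le hf hY ht
  rw [sub_self, sub_self, norm_zero, norm_zero, mul_zero, gronwallBound_ε0_δ0] at this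
  exact sub_eq_zero.1 (norm_le_zero_iff.1 this)

theorem wellPosed_of_lipschitzWith [CompleteSpace E] {K : ℝ≥0} (hf : LipschitzWith K f)
    (B : F →L[ℝ] E) : WellPosed f B := fun _T hT x ζ =>
  ⟨exists_isTrajectory hf hT x ζ, fun _X _Y hX hY => hX.eqOn hf hY⟩

theorem S_spec [CompleteSpace E] {K : ℝ≥0} (hf : LipschitzWith K f) (B : F →L[ℝ] E) (hT : 0 < T)
    (x : E) (ζ : C(Set.Icc (0 : ℝ) T, F)) :
    ∃ X, IsTrajectory f B T x ζ X ∧ X T = S f B T x ζ := by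
  have h := exists_isTrajectory (B := B) hf hT x ζ
  exact ⟨h.choose, h.choose_spec, by rw [S, dif_pos h]⟩

theorem IsTrajectory.eq_S [CompleteSpace E] {K : ℝ≥0} (hf : LipschitzWith K f) (hT : 0 < T)
    {x : E} {ζ : C(Set.Icc (0 : ℝ) T, F)} {X : ℝ → E} (hX : IsTrajectory f B T x ζ X) :
    X T = S f B T x ζ := by
  obtain ⟨Y, hY, hYT⟩ := S_spec hf B hT x ζ
  rw [← hYT]
  exact hX.eqOn hf hY ⟨hT.le, le_rfl⟩

theorem continuous_S [CompleteSpace E] {K : ℝ≥0} (hf : LipschitzWith K f) (B : F →L[ℝ] E)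
    (hT : 0 < T) (x : E) : Continuous (S f B T x) := by
  rw [continuous_iff_continuousAt]
  intro ξ
  obtain ⟨Y, hY, hYT⟩ := S_spec hf B hT x ξ
  rw [ContinuousAt, tendsto_iff_norm_sub_tendsto_zero]
  have hlim : Filter.Tendsto (fun ζ : C(Set.Icc (0 : ℝ) T, F) =>
      gronwallBound 0 K (‖B‖ * ‖ζ - ξ‖) T) (nhds ξ) (nhds 0) := by
    have : Continuous (fun ζ : C(Set.Icc (0 : ℝ) T, F) =>
        gronwallBound 0 K (‖B‖ * ‖ζ - ξ‖) T) :=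
      (gronwallBound_continuous_ε 0 K T).comp (by fun_prop)
    simpa [gronwallBound_ε0_δ0] using this.tendsto ξ
  refine squeeze_zero (fun _ => norm_nonneg _) (fun ζ => ?_) hlim
  obtain ⟨X, hX, hXT⟩ := S_spec hf B hT x ζ
  rw [← hXT, ← hYT]
  simpa using hX.norm_sub_le hf hY ⟨hT.le, le_rfl⟩

end ControlSystem

/-! ### Brouwer's fixed point theorem -/

namespace Brouwer

open MeasureTheory Set Polynomial

variable {E : Type*} [NormedAddCommGroup E]

section Bijective

variable [NormedSpace ℝ E] {h : E → E} {L : ℝ≥0} {t : ℝ}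

theorem injective_id_add_smul (hh : LipschitzWith L h) (ht : |t| * L < 1) :
    Function.Injective fun x => x + t • h x := by
  intro x y hxy
  have h1 : x - y = t • (h y - h x) := by
    rw [smul_sub, sub_eq_sub_iff_add_eq_add, add_comm (t • h y)]
    exact hxy
  have h2 : ‖x - y‖ ≤ (|t| * L) * ‖x - y‖ := by
    conv_lhs => rw [h1, norm_smul, Real.norm_eq_abs, norm_sub_rev]
    rw [mul_assoc]
    gcongr
    simpa [dist_eq_norm] using hh.dist_le_mul x y
  have h3 : ‖x - y‖ = 0 := by nlinarith [norm_nonneg (x - y)]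
  exact sub_eq_zero.1 (norm_eq_zero.1 h3)

theorem surjective_id_add_smul [CompleteSpace E] (hh : LipschitzWith L h) (ht : |t| * L < 1) :
    Function.Surjective fun x => x + t • h x := by
  intro y
  have hc : ContractingWith (‖t‖₊ * L) fun x => y - t • h x := by
    refine ⟨by rw [← NNReal.coe_lt_coe]; simpa using ht, LipschitzWith.of_dist_le_mul fun a b => ?_⟩
    rw [dist_eq_norm, sub_sub_sub_cancel_left, ← smul_sub, norm_smul, NNReal.coe_mul, coe_nnnorm,
      mul_assoc, norm_sub_rev]
    gcongr
    simpa [dist_eq_norm] using hh.dist_le_mul a b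
  have hx : y - t • h (hc.fixedPoint _) = hc.fixedPoint _ := hc.fixedPoint_isFixedPt
  exact ⟨hc.fixedPoint _, by simp only; nth_rw 1 [← hx]; simp⟩

/-- A small Lipschitz perturbation of the identity that vanishes outside `s` maps `s` onto `s`. -/
theorem image_id_add_smul [CompleteSpace E] (hh : LipschitzWith L h) (ht : |t| * L < 1)
    {s : Set E} (hs : ∀ x ∉ s, h x = 0) : (fun x => x + t • h x) '' s = s := by
  have hc : (fun x => x + t • h x) '' sᶜ = sᶜ :=
    (image_congr fun x hx => by simp [hs x hx]).trans (image_id _)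
  rw [← compl_inj_iff, ← hc, image_compl_eq ⟨injective_id_add_smul hh ht,
    surjective_id_add_smul hh ht⟩]

/-- By the Neumann series the determinant has no zero along the segment to the identity, so it keeps
the sign it has there. -/
theorem det_id_add_smul_pos [FiniteDimensional ℝ E] {M : E →L[ℝ] E} (ht0 : 0 ≤ t)
    (ht : t * ‖M‖ < 1) : 0 < (1 + t • M).det := by
  have hne : ∀ s ∈ Icc 0 t, (1 + s • M).det ≠ 0 := by
    intro s hs
    have hs1 : ‖-(s • M)‖ < 1 := by
      rw [norm_neg, norm_smul, Real.norm_of_nonneg hs.1]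
      exact (mul_le_mul_of_nonneg_right hs.2 (norm_nonneg _)).trans_lt ht
    have hu : IsUnit (1 + s • M) := by
      simpa using isUnit_one_sub_of_norm_lt_one hs1
    have : IsUnit (LinearMap.det ((1 + s • M : E →L[ℝ] E) : E →ₗ[ℝ] E)) :=
      (hu.map (ContinuousLinearMap.toLinearMapRingHom (R₁ := ℝ) (M₁ := E))).map LinearMap.det
    exact this.ne_zero
  have hcont : Continuous fun s : ℝ => (1 + s • M).det :=
    ContinuousLinearMap.continuous_det.comp (by fun_prop)
  by_contra hneg
  have h0 : (1 + (0 : ℝ) • M).det = 1 := by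
    simp [ContinuousLinearMap.det]
  obtain ⟨s, hs, hs0⟩ := intermediate_value_Icc' ht0 hcont.continuousOn
    (show (0 : ℝ) ∈ Icc _ _ from ⟨not_lt.1 hneg, h0 ▸ zero_le_one⟩)
  exact hne s hs hs0

theorem exists_polynomial_det [FiniteDimensional ℝ E] (M : E →L[ℝ] E) :
    ∃ p : ℝ[X], p.natDegree ≤ Module.finrank ℝ E ∧ ∀ t : ℝ, p.eval t = (1 + t • M).det := by
  let b := Module.finBasis ℝ E
  refine ⟨_, (natDegree_det_X_add_C_le (LinearMap.toMatrix b b (M : E →ₗ[ℝ] E)) 1).trans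
    (Fintype.card_fin _).le, fun t => ?_⟩
  rw [← coe_evalRingHom, RingHom.map_det, ContinuousLinearMap.det, ← LinearMap.det_toMatrix b]
  congr 1
  ext i j
  simp only [LinearMap.toMatrix_apply, Matrix.one_apply, RingHom.mapMatrix_apply, Matrix.map_apply,
    Matrix.add_apply, Matrix.smul_apply, smul_eq_mul, coe_evalRingHom, eval_mul, eval_X,
    eval_C, map_add, LinearMap.add_apply, Finsupp.add_apply, ContinuousLinearMap.toLinearMap_add,
    ContinuousLinearMap.toLinearMap_smul, LinearMap.smul_apply, map_smul, Finsupp.smul_apply,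
    ContinuousLinearMap.one_def, ContinuousLinearMap.coe_id, LinearMap.id_apply,
    Module.Basis.repr_self, Finsupp.single_apply, ContinuousLinearMap.coe_coe, eq_comm (a := j)]
  rw [add_comm]

end Bijective

variable [InnerProductSpace ℝ E]

theorem exists_polynomial_bump (x v : E) (c : ℝ) (N : ℕ) :
    ∃ p : ℝ[X], p.natDegree ≤ 2 * N ∧ ∀ t : ℝ, p.eval t = (1 - c * ‖x + t • v‖ ^ 2) ^ N := by
  refine ⟨(C (-c * ‖v‖ ^ 2) * X ^ 2 + C (-c * (2 * inner ℝ x v)) * X + C (1 - c * ‖x‖ ^ 2)) ^ N,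
    ?_, fun t => ?_⟩
  · refine natDegree_pow_le.trans ?_
    rw [mul_comm]
    gcongr
    exact natDegree_quadratic_le
  · rw [norm_add_sq_real, inner_smul_right, norm_smul, mul_pow, Real.norm_eq_abs, sq_abs]
    simp only [eval_pow, eval_add, eval_mul, eval_C, eval_X]
    congr 1
    ring

variable {h : E → E} {L : ℝ≥0} {ρ : ℝ}

theorem continuous_det_id_add_smul (hc : ContDiff ℝ 1 h) (t : ℝ) :
    Continuous fun x => (1 + t • fderiv ℝ h x).det :=
  ContinuousLinearMap.continuous_det.comp
    (continuous_const.add ((hc.continuous_fderiv one_ne_zero).const_smul t))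

variable [FiniteDimensional ℝ E] [MeasurableSpace E] [BorelSpace E]

/-- For small `t` the map is a bijection of `s` onto itself, and positivity of the Jacobian removes
the absolute value. -/
theorem integral_comp_mul_det_of_small (hc : ContDiff ℝ 1 h) (hh : LipschitzWith L h)
    {s : Set E} (hsm : MeasurableSet s) (hs : ∀ x ∉ s, h x = 0) {t : ℝ} (ht0 : 0 ≤ t)
    (ht : t * L < 1) (φ : E → ℝ) :
    ∫ x in s, φ (x + t • h x) * (1 + t • fderiv ℝ h x).det = ∫ x in s, φ x := by
  have ht' : |t| * L < 1 := by rwa [abs_of_nonneg ht0]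
  have hd : ∀ x ∈ s, HasFDerivWithinAt (fun x => x + t • h x) (1 + t • fderiv ℝ h x) s x :=
    fun x _ => ((hasFDerivAt_id x).add
      ((hc.differentiable one_ne_zero x).hasFDerivAt.const_smul t)).hasFDerivWithinAt
  have key := integral_image_eq_integral_abs_det_fderiv_smul volume hsm hd
    (injective_id_add_smul hh ht').injOn φ
  rw [image_id_add_smul hh ht' hs] at key
  rw [key]
  refine integral_congr_ae (Filter.Eventually.of_forall fun x => ?_)
  have hpos : 0 < (1 + t • fderiv ℝ h x).det := by
    refine det_id_add_smul_pos ht0 ((mul_le_mul_of_nonneg_left ?_ ht0).trans_lt ht)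
    exact norm_fderiv_le_of_lipschitz ℝ hh
  simp only [abs_of_pos hpos, smul_eq_mul, mul_comm]

/-- The change of variables formula persists for large perturbations of the identity, since both
sides depend polynomially on the size of the perturbation. -/
theorem integral_bump_comp_mul_det (hc : ContDiff ℝ 1 h) (hs : ∀ x ∉ Metric.closedBall 0 ρ, h x = 0)
    (c : ℝ) (N : ℕ) :
    ∫ x in Metric.closedBall (0 : E) ρ, (1 - c * ‖x + h x‖ ^ 2) ^ N * (1 + fderiv ℝ h x).det
      = ∫ x in Metric.closedBall (0 : E) ρ, (1 - c * ‖x‖ ^ 2) ^ N := by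
  have hcs : HasCompactSupport h := HasCompactSupport.intro (isCompact_closedBall 0 ρ) hs
  obtain ⟨L, hL⟩ := ContDiff.lipschitzWith_of_hasCompactSupport hcs hc one_ne_zero
  set D := 2 * N + Module.finrank ℝ E
  -- `D + 1` distinct small times at which the change of variables is known; Lagrange interpolation
  -- at these nodes extrapolates any polynomial of degree at most `D` to time `1`.
  let v : ℕ → ℝ := fun i => ((i + 1) * (L + 1))⁻¹
  have hv0 : ∀ i, 0 ≤ v i := fun i => by positivity
  have hv1 : ∀ i, v i * L < 1 := fun i => by
    have hL0 : (0 : ℝ) ≤ L := L.2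
    rw [inv_mul_lt_iff₀ (by positivity)]
    have : (0 : ℝ) ≤ i := by positivity
    nlinarith
  have hvi : Set.InjOn v (Finset.range (D + 1)) := by
    intro i _ j _ hij
    have h1 : ((i : ℝ) + 1) * (L + 1) = (j + 1) * (L + 1) := inv_injective hij
    have hL0 : (L : ℝ) + 1 ≠ 0 := by positivity
    have := mul_right_cancel₀ hL0 h1
    exact_mod_cast add_right_cancel this
  set a : ℕ → ℝ := fun i => (Lagrange.basis (Finset.range (D + 1)) v i).eval 1 with ha
  have hlag : ∀ p : ℝ[X], p.natDegree ≤ D →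
      p.eval 1 = ∑ i ∈ Finset.range (D + 1), a i * p.eval (v i) := by
    intro p hp
    have hdeg : p.degree < (Finset.range (D + 1)).card := by
      rw [Finset.card_range]
      exact (degree_le_of_natDegree_le hp).trans_lt (by exact_mod_cast Nat.lt_succ_self D)
    conv_lhs => rw [Lagrange.eq_interpolate hvi hdeg, Lagrange.interpolate_apply]
    simp only [eval_finsetSum, eval_mul, eval_C, ha, mul_comm]
  -- Exactness on the constant polynomial: equal values at all nodes therefore extrapolate to that
  -- value.
  have hsum : ∑ i ∈ Finset.range (D + 1), a i = 1 := by
    have := hlag 1 (by simp)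
    simpa using this.symm
  let φ : E → ℝ := fun x => (1 - c * ‖x‖ ^ 2) ^ N
  have hφ : Continuous φ := by fun_prop
  have hpt : ∀ x, φ (x + h x) * (1 + fderiv ℝ h x).det = ∑ i ∈ Finset.range (D + 1),
      a i * (φ (x + v i • h x) * (1 + v i • fderiv ℝ h x).det) := by
    intro x
    obtain ⟨p, hp, hpe⟩ := exists_polynomial_bump x (h x) c N
    obtain ⟨q, hq, hqe⟩ := exists_polynomial_det (fderiv ℝ h x)
    have := hlag (p * q) (natDegree_mul_le.trans (add_le_add hp hq))
    simpa only [eval_mul, hpe, hqe, one_smul] using this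
  calc ∫ x in Metric.closedBall (0 : E) ρ, φ (x + h x) * (1 + fderiv ℝ h x).det
      = ∫ x in Metric.closedBall (0 : E) ρ, ∑ i ∈ Finset.range (D + 1),
          a i * (φ (x + v i • h x) * (1 + v i • fderiv ℝ h x).det) := by simp only [hpt]
    _ = ∑ i ∈ Finset.range (D + 1), a i * ∫ x in Metric.closedBall (0 : E) ρ, φ x := by
      rw [integral_finsetSum]
      · refine Finset.sum_congr rfl fun i _ => ?_
        rw [integral_const_mul, integral_comp_mul_det_of_small hc hL measurableSet_closedBall hs
          (hv0 i) (hv1 i) φ]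
      · intro i _
        refine (Continuous.continuousOn ?_).integrableOn_compact (isCompact_closedBall 0 ρ)
        exact continuous_const.mul ((hφ.comp (continuous_id.add (hc.continuous.const_smul _))).mul
          (continuous_det_id_add_smul hc _))
    _ = ∫ x in Metric.closedBall (0 : E) ρ, φ x := by rw [← Finset.sum_mul, hsum, one_mul]

/-- A compactly supported `C¹` perturbation of the identity vanishes somewhere. -/
theorem exists_id_add_eq_zero (hc : ContDiff ℝ 1 h) (hρ : 0 < ρ)
    (hs : ∀ x ∉ Metric.closedBall 0 ρ, h x = 0) : ∃ x, x + h x = 0 := by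
  by_contra! hne
  set K := Metric.closedBall (0 : E) ρ
  have hK : IsCompact K := isCompact_closedBall 0 ρ
  have hKne : K.Nonempty := ⟨0, Metric.mem_closedBall_self hρ.le⟩
  have hgc : Continuous fun x => ‖x + h x‖ := (continuous_id.add hc.continuous).norm
  obtain ⟨x₀, _, hx₀⟩ := hK.exists_isMinOn hKne hgc.continuousOn
  obtain ⟨C, hC⟩ := hK.bddAbove_image hgc.continuousOn
  have hC' : ∀ x ∈ K, ‖x + h x‖ ≤ C := fun x hx => hC (mem_image_of_mem _ hx)
  set ε := min ‖x₀ + h x₀‖ ρ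
  have hε : 0 < ε := lt_min (norm_pos_iff.2 (hne x₀)) hρ
  have hεx : ∀ x ∈ K, ε ≤ ‖x + h x‖ := fun x hx => (min_le_left _ _).trans (hx₀ hx)
  set R := max C ρ
  have hR : 0 < R := lt_max_of_lt_right hρ
  set c := (R ^ 2)⁻¹
  have hcpos : 0 < c := by positivity
  have hcR : c * R ^ 2 = 1 := inv_mul_cancel₀ (by positivity)
  have hεR : ε ≤ R := (min_le_right _ _).trans (le_max_right _ _)
  set α := 1 - c * ε ^ 2
  set β := 1 - c * (ε / 2) ^ 2
  have hα0 : 0 ≤ α := by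
    have : c * ε ^ 2 ≤ c * R ^ 2 := by gcongr
    simp only [α]; linarith
  have hαβ : α < β := by
    have : 0 < c * ε ^ 2 := by positivity
    simp only [α, β]; nlinarith
  have hβ0 : 0 < β := hα0.trans_lt hαβ
  set Q := ∫ x in K, |(1 + fderiv ℝ h x).det|
  have hdet : Continuous fun x => (1 + fderiv ℝ h x).det := by
    simpa using continuous_det_id_add_smul hc 1
  set V := volume.real (Metric.closedBall (0 : E) (ε / 2))
  have hV : 0 < V := by
    refine ENNReal.toReal_pos (Metric.measure_closedBall_pos _ _ (by positivity)).ne' ?_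
    exact measure_closedBall_lt_top.ne
  have hsub : Metric.closedBall (0 : E) (ε / 2) ⊆ K :=
    Metric.closedBall_subset_closedBall (by have := min_le_right ‖x₀ + h x₀‖ ρ; linarith)
  -- The bump is at least `β ^ N` on the ball of radius `ε / 2`, but at most `α ^ N` at every `x + h
  -- x`, which stays at distance `ε` from `0`. As `α < β`, large `N` is contradictory.
  have hbound : ∀ N : ℕ, β ^ N * V ≤ α ^ N * Q := by
    intro N
    have hφint : IntegrableOn (fun x : E => (1 - c * ‖x‖ ^ 2) ^ N) K :=
      (Continuous.continuousOn (by fun_prop)).integrableOn_compact hK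
    have hnn : ∀ z : E, ‖z‖ ≤ R → 0 ≤ 1 - c * ‖z‖ ^ 2 := fun z hz => by
      have : c * ‖z‖ ^ 2 ≤ c * R ^ 2 := by gcongr
      linarith
    have hlow : β ^ N * V ≤ ∫ x in K, (1 - c * ‖x‖ ^ 2) ^ N := by
      calc β ^ N * V = ∫ x in Metric.closedBall (0 : E) (ε / 2), β ^ N := by
            rw [setIntegral_const, smul_eq_mul, mul_comm]
        _ ≤ ∫ x in Metric.closedBall (0 : E) (ε / 2), (1 - c * ‖x‖ ^ 2) ^ N := by
            refine setIntegral_mono_on (integrableOn_const measure_closedBall_lt_top.ne)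
              (hφint.mono_set hsub) measurableSet_closedBall fun x hx => ?_
            rw [mem_closedBall_zero_iff] at hx
            gcongr
            simp only [β]
            gcongr
        _ ≤ ∫ x in K, (1 - c * ‖x‖ ^ 2) ^ N := by
            refine setIntegral_mono_set hφint ?_ hsub.eventuallyLE
            filter_upwards [ae_restrict_mem measurableSet_closedBall] with x hx
            rw [mem_closedBall_zero_iff] at hx
            exact pow_nonneg (hnn x (hx.trans (le_max_right _ _))) N
    rw [← integral_bump_comp_mul_det hc hs c N] at hlow
    refine hlow.trans ?_
    rw [← integral_const_mul]
    refine setIntegral_mono_on ?_ ?_ measurableSet_closedBall fun x hx => ?_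
    · refine (Continuous.mul ?_ hdet).continuousOn.integrableOn_compact hK
      exact (continuous_const.sub (continuous_const.mul (hgc.pow 2))).pow N
    · exact (continuous_const.mul hdet.abs).continuousOn.integrableOn_compact hK
    · have h0 := hnn _ ((hC' x hx).trans (le_max_left _ _))
      refine (mul_le_mul_of_nonneg_left (le_abs_self _) (pow_nonneg h0 N)).trans ?_
      gcongr
      simp only [α]
      gcongr
      exact hεx x hx
  have hlim : Filter.Tendsto (fun N : ℕ => (α / β) ^ N * Q) Filter.atTop (nhds (0 * Q)) :=
    (tendsto_pow_atTop_nhds_zero_of_lt_one (by positivity) ((div_lt_one hβ0).2 hαβ)).mul_const Q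
  have hVle : V ≤ 0 * Q := ge_of_tendsto' hlim fun N => by
    rw [div_pow, div_mul_eq_mul_div, le_div_iff₀ (by positivity), mul_comm]
    exact hbound N
  rw [zero_mul] at hVle
  exact absurd hV (not_lt.2 hVle)

end Brouwer

section Brouwer

variable {E : Type*} [NormedAddCommGroup E] [InnerProductSpace ℝ E] [FiniteDimensional ℝ E]

/-- A continuous self-map of a Euclidean space with bounded range has a fixed point. -/
theorem exists_fixedPoint_of_norm_le {u : E → E} (hu : Continuous u) {M : ℝ} (hM : 0 ≤ M)
    (hb : ∀ x, ‖u x‖ ≤ M) : ∃ x, u x = x := by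
  borelize E
  let χ : E → ℝ := fun x => max 0 (min 1 (M + 1 - ‖x‖))
  have hχ : Continuous χ := by fun_prop
  have hχ0 : ∀ x, 0 ≤ χ x := fun x => le_max_left _ _
  have hχ1 : ∀ x, χ x ≤ 1 := fun x => max_le zero_le_one (min_le_left _ _)
  have hw : Continuous fun x => -(χ x • u x) := (hχ.smul hu).neg
  by_contra! hne
  have hw0 : ∀ x, 0 < ‖x - χ x • u x‖ := by
    intro x
    rw [norm_pos_iff, sub_ne_zero]
    intro hx
    have h1 : ‖x‖ ≤ M := by
      conv_lhs => rw [hx]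
      rw [norm_smul, Real.norm_of_nonneg (hχ0 x)]
      exact (mul_le_of_le_one_left (norm_nonneg _) (hχ1 x)).trans (hb x)
    have h2 : χ x = 1 := by
      simp only [χ]
      rw [min_eq_left (by linarith), max_eq_right zero_le_one]
    rw [h2, one_smul] at hx
    exact hne x hx.symm
  -- The error is strictly less than `‖x - χ x • u x‖`, so `x + v x` cannot vanish, while the
  -- support of `v` stays inside that of the cutoff.
  obtain ⟨v, hv, hvd, hvs⟩ := hw.exists_contDiff_approx 1
    (ε := fun x => ‖x - χ x • u x‖) (by fun_prop) hw0
  obtain ⟨x, hx⟩ := Brouwer.exists_id_add_eq_zero (h := v) (ρ := M + 1) hv (by linarith) (by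
    intro x hx
    by_contra hvx
    have := hvs hvx
    rw [mem_closedBall_zero_iff, not_le] at hx
    apply this
    simp only [χ]
    rw [max_eq_left ((min_le_right _ _).trans (by linarith)), zero_smul, neg_zero])
  have := hvd x
  rw [dist_eq_norm, eq_neg_of_add_eq_zero_right hx, norm_sub_rev] at this
  apply this.ne
  congr 1
  abel

/-- **Brouwer's fixed point theorem** for closed balls. -/
theorem exists_fixedPoint_closedBall {R : ℝ} (hR : 0 < R) {u : E → E}
    (hu : ContinuousOn u (Metric.closedBall 0 R))
    (hb : Set.MapsTo u (Metric.closedBall 0 R) (Metric.closedBall 0 R)) :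
    ∃ x ∈ Metric.closedBall 0 R, u x = x := by
  have hmem : ∀ x : E, radialRetraction R x ∈ Metric.closedBall (0 : E) R := fun x =>
    mem_closedBall_zero_iff.2 (norm_radialRetraction_le hR x)
  obtain ⟨x, hx⟩ := exists_fixedPoint_of_norm_le
    (hu.comp_continuous (lipschitzWith_radialRetraction hR).continuous hmem) hR.le
    fun x => mem_closedBall_zero_iff.1 (hb (hmem x))
  have hxR : ‖x‖ ≤ R := by
    rw [← hx]
    exact mem_closedBall_zero_iff.1 (hb (hmem x))
  rw [Function.comp_apply, radialRetraction_of_norm_le hR hxR] at hx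
  exact ⟨x, mem_closedBall_zero_iff.2 hxR, hx⟩

end Brouwer

/-- Linearity in the data `δ` and `ε` is what lets sublinear errors be compared with `‖z‖` and
`‖x‖`. -/
theorem gronwallBound_eq (δ K ε t : ℝ) :
    gronwallBound δ K ε t = δ * gronwallBound 1 K 0 t + ε * gronwallBound 0 K 1 t := by
  unfold gronwallBound
  split_ifs <;> ring

namespace ControlSystem

variable {E F : Type*} [NormedAddCommGroup E] [NormedSpace ℝ E]
  [NormedAddCommGroup F] [NormedSpace ℝ F] {B : F →L[ℝ] E} {T : ℝ} {A : E →L[ℝ] E}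

/-! ### Controllability of linear systems -/

theorem IsTrajectory.add {x y : E} {ζ ξ : C(Set.Icc (0 : ℝ) T, F)} {X Y : ℝ → E}
    (hX : IsTrajectory A B T x ζ X) (hY : IsTrajectory A B T y ξ Y) :
    IsTrajectory A B T (x + y) (ζ + ξ) (X + Y) := by
  refine ⟨by simp [hX.1, hY.1], fun t => ?_⟩
  convert (hX.2 t).add (hY.2 t) using 1
  simp only [Pi.add_apply, map_add, ContinuousMap.add_apply]
  abel

theorem IsTrajectory.smul {x : E} {ζ : C(Set.Icc (0 : ℝ) T, F)} {X : ℝ → E} (c : ℝ)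
    (hX : IsTrajectory A B T x ζ X) : IsTrajectory A B T (c • x) (c • ζ) (c • X) := by
  refine ⟨by simp [hX.1], fun t => ?_⟩
  convert (hX.2 t).const_smul c using 1
  simp

theorem isTrajectory_zero : IsTrajectory A B T 0 (0 : C(Set.Icc (0 : ℝ) T, F)) 0 := by
  refine ⟨rfl, fun t => ?_⟩
  exact (hasDerivWithinAt_const (t : ℝ) (Set.Icc 0 T) (0 : E)).congr_deriv (by simp)

/-- The endpoint of the trajectory from `0` of a linear system, as a linear function of the
control. -/
def endpoint [CompleteSpace E] (A : E →L[ℝ] E) (B : F →L[ℝ] E) (hT : 0 < T) :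
    C(Set.Icc (0 : ℝ) T, F) →ₗ[ℝ] E where
  toFun := S A B T 0
  map_add' ζ ξ := by
    obtain ⟨X, hX, hXT⟩ := S_spec A.lipschitz B hT 0 ζ
    obtain ⟨Y, hY, hYT⟩ := S_spec A.lipschitz B hT 0 ξ
    have := hX.add hY
    rw [add_zero] at this
    rw [← this.eq_S A.lipschitz hT, Pi.add_apply, hXT, hYT]
  map_smul' c ζ := by
    obtain ⟨X, hX, hXT⟩ := S_spec A.lipschitz B hT 0 ζ
    have := hX.smul c
    rw [smul_zero] at this
    rw [← this.eq_S A.lipschitz hT, Pi.smul_apply, hXT, RingHom.id_apply]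

end ControlSystem

namespace ControlSystem

variable {E F : Type*} [NormedAddCommGroup E] [InnerProductSpace ℝ E] [FiniteDimensional ℝ E]
  [NormedAddCommGroup F] [InnerProductSpace ℝ F] [CompleteSpace F]
  {B : F →L[ℝ] E} {T : ℝ} {A : E →L[ℝ] E}

/-- Observability of the pair `(C, A)`: only `0` has vanishing outputs `C A ^ k y`. -/
def Observable {G : Type*} [NormedAddCommGroup G] [NormedSpace ℝ G] (C : E →L[ℝ] G)
    (A : E →L[ℝ] E) : Prop :=
  ∀ y : E, (∀ k : ℕ, C ((A ^ k) y) = 0) → y = 0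

theorem hasDerivAt_exp_sub_smul (M : E →L[ℝ] E) (η : E) (T t : ℝ) :
    HasDerivAt (fun s : ℝ => NormedSpace.exp ((T - s) • M) η)
      (-(M (NormedSpace.exp ((T - t) • M) η))) t := by
  have h1 : HasDerivAt (fun s : ℝ => NormedSpace.exp ((T - s) • M))
      (-(M * NormedSpace.exp ((T - t) • M))) t := by
    rw [← neg_one_smul ℝ]
    exact (hasDerivAt_exp_smul_const' (𝕂 := ℝ) M (T - t)).scomp t ((hasDerivAt_id t).const_sub T)
  simpa using h1.clm_apply (hasDerivAt_const t η)

/-- Duality: let `η` be orthogonal to the range and `Y` the adjoint trajectory ending at `η`. Under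
the control `B^* Y`, the pairing of `Y` with the state has derivative `‖B^* Y‖²` and vanishes at
both ends, so `B^* Y = 0`. Differentiating repeatedly and evaluating at `T` gives `η = 0`. -/
theorem range_endpoint (hT : 0 < T)
    (hobs : Observable (ContinuousLinearMap.adjoint B) (ContinuousLinearMap.adjoint A)) :
    LinearMap.range (endpoint A B hT) = ⊤ := by
  by_contra hne
  set M := ContinuousLinearMap.adjoint A
  set C := ContinuousLinearMap.adjoint B
  have hbot : (LinearMap.range (endpoint A B hT))ᗮ ≠ ⊥ := fun h =>
    hne (Submodule.orthogonal_eq_bot_iff.1 h)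
  obtain ⟨η, hη, hη0⟩ := Submodule.exists_mem_ne_zero_of_ne_bot hbot
  let Y : ℝ → E := fun s => NormedSpace.exp ((T - s) • M) η
  have hY : ∀ t, HasDerivAt Y (-(M (Y t))) t := hasDerivAt_exp_sub_smul M η T
  have hYT : Y T = η := by simp [Y]
  have hYc : Continuous Y := continuous_iff_continuousAt.2 fun t => (hY t).continuousAt
  let ζ : C(Set.Icc (0 : ℝ) T, F) := ⟨fun t => C (Y t), by fun_prop⟩
  obtain ⟨Z, hZ, hZT⟩ := S_spec A.lipschitz B hT 0 ζ
  have hm : ∀ t ∈ Set.Icc 0 T,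
      HasDerivWithinAt (fun s => inner ℝ (Y s) (Z s)) (‖C (Y t)‖ ^ 2) (Set.Icc 0 T) t := by
    intro t ht
    have := (hY t).hasDerivWithinAt.inner ℝ (hZ.hasDerivWithinAt ht)
    refine this.congr_deriv ?_
    have h1 : inner ℝ (M (Y t)) (Z t) = inner ℝ (Y t) (A (Z t)) :=
      ContinuousLinearMap.adjoint_inner_left A _ _
    have h2 : inner ℝ (Y t) (B (C (Y t))) = ‖C (Y t)‖ ^ 2 := by
      rw [← ContinuousLinearMap.adjoint_inner_left, real_inner_self_eq_norm_sq]
    change inner ℝ (Y t) (A (Z t) + B (C (Y t))) + _ = _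
    rw [inner_add_right, inner_neg_left, h1, h2]
    ring
  have hmono : MonotoneOn (fun s => inner ℝ (Y s) (Z s)) (Set.Icc 0 T) := by
    refine monotoneOn_of_hasDerivWithinAt_nonneg (f' := fun t => ‖C (Y t)‖ ^ 2)
      (convex_Icc 0 T) (fun t ht => (hm t ht).continuousWithinAt) (fun t ht => ?_)
      fun t _ => by positivity
    exact (hm t (interior_subset ht)).mono interior_subset
  have hm0 : inner ℝ (Y 0) (Z 0) = 0 := by rw [hZ.1, inner_zero_right]
  have hmT : inner ℝ (Y T) (Z T) = 0 := by
    rw [hYT, hZT, real_inner_comm]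
    exact hη _ ⟨ζ, rfl⟩
  have hzero : ∀ t ∈ Set.Icc 0 T, inner ℝ (Y t) (Z t) = 0 := fun t ht =>
    le_antisymm ((hmono ht ⟨hT.le, le_rfl⟩ ht.2).trans hmT.le)
      (hm0.symm.le.trans (hmono ⟨le_rfl, hT.le⟩ ht ht.1))
  have huniq := uniqueDiffOn_Icc hT
  have hout : ∀ k : ℕ, ∀ t ∈ Set.Icc 0 T, C ((M ^ k) (Y t)) = 0 := by
    intro k
    induction k with
    | zero =>
      intro t ht
      have h1 := (hm t ht).congr_of_mem (f₁ := fun _ => (0 : ℝ)) (fun s hs => (hzero s hs).symm) ht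
      have h2 := (huniq t ht).eq_deriv _ h1 (hasDerivWithinAt_const t _ 0)
      simpa using h2
    | succ k ih =>
      intro t ht
      have h1 : HasDerivWithinAt (fun s => C ((M ^ k) (Y s))) (C ((M ^ k) (-(M (Y t)))))
          (Set.Icc 0 T) t :=
        ((C ∘L (M ^ k)).hasFDerivAt.comp_hasDerivAt t (hY t)).hasDerivWithinAt
      have h2 := h1.congr_of_mem (f₁ := fun _ => (0 : F)) (fun s hs => (ih s hs).symm) ht
      have h3 := (huniq t ht).eq_deriv _ h2 (hasDerivWithinAt_const t _ 0)
      rw [map_neg, map_neg, neg_eq_zero] at h3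
      rw [pow_succ]
      exact h3
  exact hη0 (hobs η fun k => by simpa only [hYT] using hout k T ⟨hT.le, le_rfl⟩)

/-- A linear system with observable dual can be steered from `0` to any point by a control
depending linearly on that point. -/
theorem exists_linear_steering (hT : 0 < T)
    (hobs : Observable (ContinuousLinearMap.adjoint B) (ContinuousLinearMap.adjoint A)) :
    ∃ R : E →L[ℝ] C(Set.Icc (0 : ℝ) T, F), ∀ z, S A B T 0 (R z) = z := by
  obtain ⟨R, hR⟩ := (endpoint A B hT).exists_rightInverse_of_surjective (range_endpoint hT hobs)
  exact ⟨LinearMap.toContinuousLinearMap R, fun z => LinearMap.congr_fun hR z⟩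

/-! ### Sublinear perturbations -/

variable {f : E → E} {K : ℝ≥0}

/-- Under a sublinear perturbation, the steering controls of the linear system are off by a
sublinear error. -/
theorem exists_steering_error_le (hf : LipschitzWith K f) (hT : 0 < T)
    (hobs : Observable (ContinuousLinearMap.adjoint B) (ContinuousLinearMap.adjoint A))
    (hsub : ∀ δ : ℝ, 0 < δ → ∃ C : ℝ, ∀ y, ‖f y - A y‖ ≤ δ * ‖y‖ + C) :
    ∃ (R : E →L[ℝ] C(Set.Icc (0 : ℝ) T, F)) (C : ℝ), 0 ≤ C ∧
      ∀ x z, ‖S f B T x (R z) - z‖ ≤ ‖z‖ / 2 + C * (1 + ‖x‖) := by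
  obtain ⟨R, hR⟩ := exists_linear_steering hT hobs
  have hG : ∀ {δ K ε : ℝ}, 0 ≤ δ → 0 ≤ K → 0 ≤ ε → 0 ≤ gronwallBound δ K ε T :=
    fun hδ hK hε => gronwallBound_nonneg hδ hK hε hT.le
  have hA1 : 0 ≤ ‖A‖ + 1 := by positivity
  set b := ‖B‖ * ‖R‖ * gronwallBound 0 ‖A‖ 1 T
  have hb : 0 ≤ b := mul_nonneg (by positivity) (hG le_rfl (norm_nonneg _) zero_le_one)
  set G1 := gronwallBound 1 (‖A‖ + 1) 0 T
  have hG1 : 0 ≤ G1 := hG zero_le_one hA1 le_rfl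
  set G2 := gronwallBound 0 (‖A‖ + 1) 1 T
  have hG2 : 0 ≤ G2 := hG le_rfl hA1 zero_le_one
  -- The `1` keeps the Grönwall rate below `‖A‖ + 1` independently of `δ`; the other bound makes the
  -- error produced by the linear trajectory at most `‖z‖ / 2`.
  set δ := min 1 (2 * (b * G2 + 1))⁻¹
  have hδ : 0 < δ := lt_min one_pos (by positivity)
  have hδb : δ * b * G2 ≤ 1 / 2 := by
    have h1 : δ * (b * G2) ≤ (2 * (b * G2 + 1))⁻¹ * (b * G2) :=
      mul_le_mul_of_nonneg_right (min_le_right _ _) (by positivity)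
    have h2 : (2 * (b * G2 + 1))⁻¹ * (b * G2) ≤ 1 / 2 := by
      have : 0 ≤ b * G2 := by positivity
      rw [inv_mul_le_iff₀ (by positivity)]
      linarith
    linarith [mul_assoc δ b G2]
  obtain ⟨C, hC⟩ := hsub δ hδ
  refine ⟨R, G1 + |C| * G2, by positivity, fun x z => ?_⟩
  obtain ⟨X, hX, hXT⟩ := S_spec hf B hT x (R z)
  obtain ⟨Z, hZ, hZT⟩ := S_spec A.lipschitz B hT 0 (R z)
  rw [hR] at hZT
  have hZb : ∀ t ∈ Set.Icc 0 T, ‖Z t‖ ≤ b * ‖z‖ := by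
    intro t ht
    have h := hZ.norm_sub_le A.lipschitz isTrajectory_zero ht
    rw [Pi.zero_apply, sub_zero, sub_zero, sub_zero, norm_zero, coe_nnnorm] at h
    refine h.trans ((gronwallBound_mono le_rfl (by positivity) (norm_nonneg _) ht.2).trans ?_)
    rw [gronwallBound_eq, zero_mul, zero_add]
    have h2 := mul_le_mul_of_nonneg_right (mul_le_mul_of_nonneg_left (R.le_opNorm z)
      (norm_nonneg B)) (hG (le_refl 0) (norm_nonneg A) zero_le_one)
    refine h2.trans (le_of_eq ?_)
    simp only [b]
    ring
  have hD := norm_le_gronwallBound (X := fun t => X t - Z t)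
    (X' := fun t => f (X t) - A (Z t)) (T := T) (δ := ‖x‖) (K := ‖A‖ + 1)
    (ε := δ * b * ‖z‖ + |C|) (by simp [hX.1, hZ.1])
    (fun t ht => by
      have := (hX.hasDerivWithinAt ht).sub (hZ.hasDerivWithinAt ht)
      rwa [add_sub_add_right_eq_sub] at this)
    (fun t ht => by
      have h1 : f (X t) - A (Z t) = A (X t - Z t) + (f (X t) - A (X t)) := by
        rw [map_sub]; abel
      have h2 : ‖X t‖ ≤ ‖X t - Z t‖ + ‖Z t‖ := norm_le_norm_sub_add _ _
      have h3 : δ * ‖X t‖ ≤ δ * ‖X t - Z t‖ + δ * (b * ‖z‖) := by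
        rw [← mul_add]
        exact mul_le_mul_of_nonneg_left (h2.trans (by linarith [hZb t ht])) hδ.le
      have h4 : δ * ‖X t - Z t‖ ≤ 1 * ‖X t - Z t‖ :=
        mul_le_mul_of_nonneg_right (min_le_left _ _) (norm_nonneg _)
      rw [h1]
      refine (norm_add_le _ _).trans ?_
      linarith [A.le_opNorm (X t - Z t), hC (X t), le_abs_self C])
    T ⟨hT.le, le_rfl⟩
  rw [hXT, hZT] at hD
  refine hD.trans ?_
  rw [gronwallBound_eq]
  have h5 : δ * b * G2 * ‖z‖ ≤ 1 / 2 * ‖z‖ := mul_le_mul_of_nonneg_right hδb (norm_nonneg z)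
  have h6 : 0 ≤ |C| * G2 * ‖x‖ := by positivity
  change ‖x‖ * G1 + (δ * b * ‖z‖ + |C|) * G2 ≤ _
  linarith

/-- A continuous map at sublinear distance from the identity takes all values of a ball. -/
theorem exists_eq_of_error_le {Ψ : E → E} {R M : ℝ} (hR : 0 < R) (hRM : 2 * M ≤ R)
    (hΨ : ContinuousOn Ψ (Metric.closedBall 0 R)) {g : E}
    (h : ∀ z ∈ Metric.closedBall 0 R, ‖Ψ z - z‖ + ‖g‖ ≤ ‖z‖ / 2 + M) :
    ∃ z ∈ Metric.closedBall 0 R, Ψ z = g := by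
  -- A fixed point of `z + g - Ψ z` solves `Ψ z = g`; the condition `2 * M ≤ R` makes the ball
  -- invariant.
  obtain ⟨z, hz, hzz⟩ := exists_fixedPoint_closedBall (u := fun z => z + g - Ψ z) hR
    ((continuousOn_id.add continuousOn_const).sub hΨ) fun z hz => by
      have h1 := h z hz
      rw [mem_closedBall_zero_iff] at hz ⊢
      have h2 : z + g - Ψ z = g - (Ψ z - z) := by abel
      simp only [h2]
      refine (norm_sub_le _ _).trans ?_
      linarith
  refine ⟨z, hz, ?_⟩
  rw [add_sub_assoc, add_eq_left, sub_eq_zero] at hzz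
  exact hzz.symm

theorem approxControllableTo_of_sublinear (hf : LipschitzWith K f)
    (hobs : Observable (ContinuousLinearMap.adjoint B) (ContinuousLinearMap.adjoint A))
    (hsub : ∀ δ : ℝ, 0 < δ → ∃ C : ℝ, ∀ y, ‖f y - A y‖ ≤ δ * ‖y‖ + C) (xhat : E) :
    ApproxControllableTo f B xhat := by
  intro ε r hε hr
  obtain ⟨R, C, hC, h⟩ := exists_steering_error_le hf one_pos hobs hsub
  refine ⟨1, one_pos, fun x hx => ?_⟩
  obtain ⟨z, -, hz⟩ := exists_eq_of_error_le (Ψ := fun z => S f B 1 x (R z))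
    (R := 2 * (C * (1 + ‖x‖) + ‖xhat‖) + 1) (M := C * (1 + ‖x‖) + ‖xhat‖) (by positivity)
    (by linarith)
    ((continuous_S hf B one_pos x).comp R.continuous).continuousOn (g := xhat)
    fun z _ => by linarith [h x z]
  exact ⟨R z, by rw [hz, sub_self, norm_zero]; exact hε⟩

theorem solidlyControllableFrom_of_sublinear (hf : LipschitzWith K f)
    (hobs : Observable (ContinuousLinearMap.adjoint B) (ContinuousLinearMap.adjoint A))
    (hsub : ∀ δ : ℝ, 0 < δ → ∃ C : ℝ, ∀ y, ‖f y - A y‖ ≤ δ * ‖y‖ + C) (xhat : E) :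
    SolidlyControllableFrom f B xhat := by
  obtain ⟨R, C, hC, h⟩ := exists_steering_error_le hf one_pos hobs hsub
  -- The `2` pays for the tolerance `ε₀ = 1` and for the radius `1` of the target ball.
  set M := C * (1 + ‖xhat‖) + 2
  have hM : 0 < 2 * M := by positivity
  have hmem : ∀ z ∈ Metric.closedBall (0 : E) (2 * M), R z ∈ R '' Metric.closedBall 0 (2 * M) :=
    fun z hz => Set.mem_image_of_mem R hz
  refine ⟨1, 1, one_pos, one_pos, R '' Metric.closedBall 0 (2 * M),
    (isCompact_closedBall 0 _).image R.continuous, 0, 1, one_pos, fun Φ hΦ hd g hg => ?_⟩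
  let P : E → R '' Metric.closedBall (0 : E) (2 * M) := fun z =>
    ⟨R (radialRetraction (2 * M) z),
      hmem _ (mem_closedBall_zero_iff.2 (norm_radialRetraction_le hM z))⟩
  have hP : Continuous P :=
    (R.continuous.comp (lipschitzWith_radialRetraction hM).continuous).subtype_mk _
  obtain ⟨z, -, hz⟩ := exists_eq_of_error_le (Ψ := fun z => Φ (P z)) hM le_rfl
    (hΦ.comp hP).continuousOn (g := g) fun z hz => by
      have h1 := hd (P z)
      have h2 := h xhat z
      rw [mem_closedBall_zero_iff] at hz hg
      have h3 : ((P z : C(Set.Icc (0 : ℝ) 1, F))) = R z := by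
        simp only [P, radialRetraction_of_norm_le hM hz]
      rw [h3] at h1
      have h4 := norm_sub_le_norm_sub_add_norm_sub (Φ (P z)) (S f B 1 xhat (R z)) z
      simp only [M]
      linarith
  exact ⟨P z, hz⟩

end ControlSystem

namespace ControlSystem

variable {E G : Type*} [NormedAddCommGroup E] [InnerProductSpace ℝ E]
  [NormedAddCommGroup G] [InnerProductSpace ℝ G] {A : E →L[ℝ] E} {C : E →L[ℝ] G}

/-! ### A strict Lyapunov form -/

/-- The symmetrized product of the outputs of order `k` and `k + 1`. -/
def crossForm (C : E →L[ℝ] G) (A : E →L[ℝ] E) (k : ℕ) : LinearMap.BilinForm ℝ E :=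
  LinearMap.mk₂ ℝ (fun x y => inner ℝ (C ((A ^ k) x)) (C ((A ^ (k + 1)) y))
      + inner ℝ (C ((A ^ (k + 1)) x)) (C ((A ^ k) y)))
    (fun _ _ _ => by simp only [map_add, inner_add_left]; ring)
    (fun _ _ _ => by simp only [map_smul, real_inner_smul_left, smul_eq_mul]; ring)
    (fun _ _ _ => by simp only [map_add, inner_add_right]; ring)
    (fun _ _ _ => by simp only [map_smul, real_inner_smul_right, smul_eq_mul]; ring)

theorem crossForm_symm (k : ℕ) (x y : E) : crossForm C A k x y = crossForm C A k y x := by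
  simp only [crossForm, LinearMap.mk₂_apply]
  rw [real_inner_comm, add_comm, real_inner_comm]

/-- Along the linear flow the cross form produces the square of output `k + 1`, up to a product
containing output `k`. -/
theorem crossForm_apply_self (k : ℕ) (y : E) : crossForm C A k (A y) y =
    ‖C ((A ^ (k + 1)) y)‖ ^ 2 + inner ℝ (C ((A ^ (k + 2)) y)) (C ((A ^ k) y)) := by
  have h : ∀ n, (A ^ n) (A y) = (A ^ (n + 1)) y := fun n => by rw [pow_succ]; rfl
  simp only [crossForm, LinearMap.mk₂_apply, h, real_inner_self_eq_norm_sq]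

variable [FiniteDimensional ℝ E]

/-- Observability is witnessed, quantitatively, by finitely many outputs. -/
theorem Observable.exists_norm_sq_le (h : Observable C A) :
    ∃ (N : ℕ) (M : ℝ), 0 ≤ M ∧
      ∀ y, ‖y‖ ^ 2 ≤ M * ∑ i ∈ Finset.range (N + 1), ‖C ((A ^ i) y)‖ ^ 2 := by
  let V : ℕ →o (Submodule ℝ E)ᵒᵈ :=
    ⟨fun n => OrderDual.toDual
        (⨅ i ∈ Finset.range (n + 1), LinearMap.ker ((C ∘L A ^ i : E →L[ℝ] G) : E →ₗ[ℝ] G)),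
      fun m n hmn => OrderDual.toDual_le_toDual.2 (biInf_mono fun i hi => by
        rw [Finset.mem_range] at hi ⊢; omega)⟩
  obtain ⟨N, hN⟩ := IsArtinian.monotone_stabilizes V
  have hV : ∀ n y, y ∈ OrderDual.ofDual (V n) ↔ ∀ i < n + 1, C ((A ^ i) y) = 0 := by
    intro n y
    change y ∈ (⨅ i ∈ Finset.range (n + 1),
      LinearMap.ker ((C ∘L A ^ i : E →L[ℝ] G) : E →ₗ[ℝ] G)) ↔ _
    simp only [Submodule.mem_iInf, Finset.mem_range]
    rfl
  let O : E →ₗ[ℝ] (Fin (N + 1) → G) :=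
    LinearMap.pi fun i => ((C ∘L A ^ (i : ℕ) : E →L[ℝ] G) : E →ₗ[ℝ] G)
  have hO : ∀ y i, O y i = C ((A ^ (i : ℕ)) y) := fun _ _ => rfl
  have hker : LinearMap.ker O = ⊥ := by
    rw [LinearMap.ker_eq_bot']
    intro y hy
    refine h y fun k => ?_
    have h1 : y ∈ OrderDual.ofDual (V N) := (hV N y).2 fun i hi => by
      rw [← hO y ⟨i, hi⟩, hy]; rfl
    rw [hN (max N k) (le_max_left _ _)] at h1
    exact (hV _ y).1 h1 k (by omega)
  obtain ⟨K, -, hK⟩ := O.exists_antilipschitzWith hker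
  refine ⟨N, K ^ 2, by positivity, fun y => ?_⟩
  have h1 : ‖y‖ ≤ K * ‖O y‖ := by simpa using hK.le_mul_dist y 0
  set Q := ∑ i ∈ Finset.range (N + 1), ‖C ((A ^ i) y)‖ ^ 2
  have hQ0 : 0 ≤ Q := Finset.sum_nonneg fun _ _ => by positivity
  have h2 : ‖O y‖ ≤ Real.sqrt Q := by
    refine (pi_norm_le_iff_of_nonneg (Real.sqrt_nonneg _)).2 fun i => Real.le_sqrt_of_sq_le ?_
    rw [hO]
    exact Finset.single_le_sum (f := fun i => ‖C ((A ^ i) y)‖ ^ 2) (fun _ _ => by positivity)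
      (Finset.mem_range.2 i.2)
  calc ‖y‖ ^ 2 ≤ (K * Real.sqrt Q) ^ 2 := by
        gcongr
        exact h1.trans (by gcongr)
    _ = K ^ 2 * Q := by rw [mul_pow, Real.sq_sqrt hQ0]

/-- Start from the observability estimate and remove the highest output by subtracting a multiple of
a cross form, descending until only `C y` is left. -/
theorem exists_symm_form_le (h : Observable C A) :
    ∃ (b : LinearMap.BilinForm ℝ E) (M : ℝ), (∀ x y, b x y = b y x) ∧ 0 ≤ M ∧
      ∀ y, b (A y) y ≤ -‖y‖ ^ 2 + M * ‖C y‖ ^ 2 := by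
  obtain ⟨N, M, hM, hN⟩ := h.exists_norm_sq_le
  suffices H : ∀ k, k ≤ N → ∃ (b : LinearMap.BilinForm ℝ E) (M : ℝ), (∀ x y, b x y = b y x) ∧
      0 ≤ M ∧ ∀ y, b (A y) y ≤ -‖y‖ ^ 2 + M * ∑ i ∈ Finset.range (k + 1), ‖C ((A ^ i) y)‖ ^ 2 by
    simpa using H 0 N.zero_le
  intro k hk
  induction hk using Nat.decreasingInduction with
  | self => exact ⟨0, M, fun _ _ => rfl, hM, fun y => by simpa using hN y⟩
  | of_succ k _ ih =>
    obtain ⟨b, M, hsymm, hM, hb⟩ := ih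
    set Λ := ‖C ∘L A ^ (k + 2)‖
    -- Young's inequality on the cross product spends half of `‖y‖ ^ 2`; the factor `2` restores it.
    refine ⟨(2 : ℝ) • (b - M • crossForm C A k), 2 * (M + M ^ 2 * Λ ^ 2 / 2), fun x y => ?_,
      by positivity, fun y => ?_⟩
    · simp only [LinearMap.smul_apply, LinearMap.sub_apply, hsymm x y, crossForm_symm k x y]
    · simp only [LinearMap.smul_apply, LinearMap.sub_apply, crossForm_apply_self, smul_eq_mul]
      have h1 := hb y
      rw [Finset.sum_range_succ] at h1
      set Q := ∑ i ∈ Finset.range (k + 1), ‖C ((A ^ i) y)‖ ^ 2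
      have h2 : ‖C ((A ^ k) y)‖ ^ 2 ≤ Q :=
        Finset.single_le_sum (f := fun i => ‖C ((A ^ i) y)‖ ^ 2) (fun _ _ => by positivity)
          (Finset.mem_range.2 k.lt_succ_self)
      have h3 : |inner ℝ (C ((A ^ (k + 2)) y)) (C ((A ^ k) y))| ≤
          (Λ * ‖y‖) * ‖C ((A ^ k) y)‖ := (abs_real_inner_le_norm _ _).trans
        (mul_le_mul_of_nonneg_right ((C ∘L A ^ (k + 2)).le_opNorm y) (norm_nonneg _))
      have h4 := mul_le_mul_of_nonneg_left ((neg_le_abs _).trans h3) hM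
      have h5 := mul_le_mul_of_nonneg_left h2 (show 0 ≤ M ^ 2 * Λ ^ 2 / 2 by positivity)
      nlinarith [sq_nonneg (‖y‖ - M * Λ * ‖C ((A ^ k) y)‖)]

theorem exists_norm_bilinForm_le (b : LinearMap.BilinForm ℝ E) :
    ∃ Λ : ℝ, 0 ≤ Λ ∧ ∀ x y, |b x y| ≤ Λ * ‖x‖ * ‖y‖ := by
  let b' : E →L[ℝ] E →L[ℝ] ℝ := LinearMap.toContinuousLinearMap
    ((LinearMap.toContinuousLinearMap : (E →ₗ[ℝ] ℝ) ≃ₗ[ℝ] (E →L[ℝ] ℝ)) ∘ₗ b)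
  exact ⟨‖b'‖, norm_nonneg b', fun x y => b'.le_opNorm₂ x y⟩

/-- A dissipative linear system with observable dissipation has a strict Lyapunov form. -/
theorem exists_lyapunov_form (h : Observable C A) {c : ℝ} (hc : 0 < c)
    (hA : ∀ y, inner ℝ (A y) y ≤ -(c * ‖C y‖ ^ 2)) :
    ∃ b : LinearMap.BilinForm ℝ E, IsScalarProduct b ∧ ∀ y, b (A y) y ≤ -‖y‖ ^ 2 := by
  obtain ⟨b, M, hsymm, hM, hb⟩ := exists_symm_form_le h
  obtain ⟨Λ, hΛ, hbΛ⟩ := exists_norm_bilinForm_le b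
  -- `M / c` lets the dissipation absorb `M * ‖C y‖ ^ 2`; `Λ + 1` makes the form positive definite.
  set l := M / c + Λ + 1
  have hl : 0 ≤ l := by positivity
  refine ⟨b + l • innerₗ E, ⟨fun x y => ?_, fun x hx => ?_⟩, fun y => ?_⟩
  · simp only [LinearMap.add_apply, LinearMap.smul_apply, innerₗ_apply_apply,
      hsymm x y, real_inner_comm]
  · simp only [LinearMap.add_apply, LinearMap.smul_apply, innerₗ_apply_apply,
      real_inner_self_eq_norm_sq, smul_eq_mul]
    have h1 := neg_le_of_abs_le (hbΛ x x)
    have h2 : 0 < ‖x‖ ^ 2 := by positivity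
    have h3 : 0 ≤ M / c := by positivity
    simp only [l]
    nlinarith
  · simp only [LinearMap.add_apply, LinearMap.smul_apply, innerₗ_apply_apply,
      smul_eq_mul]
    have h1 := mul_le_mul_of_nonneg_left (hA y) hl
    have h2 : M ≤ l * c := by
      have : M / c * c = M := div_mul_cancel₀ M hc.ne'
      simp only [l]
      nlinarith
    have h3 := mul_le_mul_of_nonneg_right h2 (sq_nonneg ‖C y‖)
    linarith [hb y]

theorem exists_dissipative_of_sublinear {f : E → E} (h : Observable C A) {c : ℝ} (hc : 0 < c)
    (hA : ∀ y, inner ℝ (A y) y ≤ -(c * ‖C y‖ ^ 2))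
    (hsub : ∀ δ : ℝ, 0 < δ → ∃ C : ℝ, ∀ y, ‖f y - A y‖ ≤ δ * ‖y‖ + C) :
    ∃ b : LinearMap.BilinForm ℝ E, IsScalarProduct b ∧ Dissipative b f := by
  obtain ⟨b, hb, hbA⟩ := exists_lyapunov_form h hc hA
  obtain ⟨Λ, hΛ, hbΛ⟩ := exists_norm_bilinForm_le b
  -- The linear part of the error costs a quarter of `‖y‖ ^ 2` and, by Young, the constant part
  -- another quarter; the remaining half dominates `α * b y y`.
  obtain ⟨D, hD⟩ := hsub (4 * (Λ + 1))⁻¹ (by positivity)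
  refine ⟨b, hb, (2 * (Λ + 1))⁻¹, Λ ^ 2 * D ^ 2 + 1, by positivity, by positivity, fun y => ?_⟩
  have h1 : b (f y) y = b (A y) y + b (f y - A y) y := by
    rw [map_sub, LinearMap.sub_apply]; ring
  have h2 : b (f y - A y) y ≤ Λ * ((4 * (Λ + 1))⁻¹ * ‖y‖ + D) * ‖y‖ :=
    (le_of_abs_le (hbΛ _ _)).trans (by gcongr; exact hD y)
  have h3 : Λ * (4 * (Λ + 1))⁻¹ ≤ 1 / 4 := by
    rw [← div_eq_mul_inv, div_le_iff₀ (by positivity)]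
    linarith
  have h4 := mul_le_mul_of_nonneg_right h3 (sq_nonneg ‖y‖)
  have h5 : (2 * (Λ + 1))⁻¹ * b y y ≤ ‖y‖ ^ 2 / 2 := by
    rw [inv_mul_le_iff₀ (by positivity)]
    nlinarith [le_of_abs_le (hbΛ y y), sq_nonneg ‖y‖]
  rw [h1]
  nlinarith [hbA y, sq_nonneg (‖y‖ / 2 - Λ * D)]

end ControlSystem

/-! ### Sublinear growth of the force -/

namespace Network

variable {I : Type*} [Fintype I]

theorem CondG.exists_norm_gradient_le {U : Conf I → ℝ} (hG : CondG U) {δ : ℝ} (hδ : 0 < δ) :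
    ∃ C : ℝ, ∀ q, ‖gradient U q‖ ≤ δ * ‖q‖ + C := by
  obtain ⟨L, hL⟩ := hG.lipschitz
  have hev := hG.growth.def hδ
  rw [← Metric.comap_dist_right_atTop (0 : Conf I), Filter.eventually_comap] at hev
  obtain ⟨r, hr⟩ := Filter.eventually_atTop.1 hev
  refine ⟨2 * δ + (‖gradient U 0‖ + L * |r|), fun q => ?_⟩
  rcases le_total r ‖q‖ with h | h
  · have h1 := hr _ h q (dist_zero_right q)
    -- For empty `I`, division by zero makes the exponent `0`, so the bound still holds.
    have hexp : (1 : ℝ) / (4 * (Fintype.card I : ℝ)) ≤ 1 := by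
      rcases Nat.eq_zero_or_pos (Fintype.card I) with h0 | h0
      · simp [h0]
      · have : (1 : ℝ) ≤ Fintype.card I := by exact_mod_cast h0
        rw [div_le_one (by positivity)]
        linarith
    have h2 : ‖q‖ ^ ((1 : ℝ) / (4 * (Fintype.card I : ℝ))) ≤ 1 + ‖q‖ := by
      calc ‖q‖ ^ ((1 : ℝ) / (4 * (Fintype.card I : ℝ)))
          ≤ (1 + ‖q‖) ^ ((1 : ℝ) / (4 * (Fintype.card I : ℝ))) := by
            gcongr
            linarith
        _ ≤ (1 + ‖q‖) ^ (1 : ℝ) :=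
            Real.rpow_le_rpow_of_exponent_le (by linarith [norm_nonneg q]) hexp
        _ = 1 + ‖q‖ := Real.rpow_one _
    rw [Real.norm_of_nonneg (by positivity)] at h1
    have h3 := mul_le_mul_of_nonneg_left h2 hδ.le
    have h4 : 0 ≤ ‖gradient U 0‖ + L * |r| := by positivity
    linarith
  · have h1 := hL.dist_le_mul q 0
    rw [dist_eq_norm, dist_zero_right] at h1
    have h2 : (L : ℝ) * ‖q‖ ≤ L * |r| := by
      gcongr
      exact h.trans (le_abs_self r)
    have h3 := norm_le_norm_add_norm_sub' (gradient U q) (gradient U 0)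
    have h4 : 0 ≤ δ * ‖q‖ := by positivity
    linarith

variable [DecidableEq I] (J : Finset I) (γ : J → ℝ)

/-! ### The linear part of the network -/

theorem adjoint_iota_apply (j : J) (p : Conf I) :
    ContinuousLinearMap.adjoint (iota J j) p = p (j : I) • EuclideanSpace.single j (1 : ℝ) := by
  refine ext_inner_right ℝ fun x => ?_
  rw [ContinuousLinearMap.adjoint_inner_left]
  simp [iota, inner_smul_left, inner_smul_right, EuclideanSpace.inner_single_left,
    EuclideanSpace.inner_single_right, mul_comm]

theorem friction_apply (p : Conf I) :
    friction J γ p = ∑ j : J, (γ j * p j) • EuclideanSpace.single (j : I) (1 : ℝ) := by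
  simp only [friction, _root_.sum_apply, _root_.smul_apply,
    ContinuousLinearMap.comp_apply, adjoint_iota_apply, map_smul]
  refine Finset.sum_congr rfl fun j _ => ?_
  simp [iota, smul_smul]

theorem bath_eq_friction : bath J = friction J 1 := by
  simp [bath, friction]

theorem inner_friction (p q : Conf I) :
    inner ℝ (friction J γ p) q = ∑ j : J, γ j * p j * q j := by
  simp [friction_apply, sum_inner, inner_smul_left, EuclideanSpace.inner_single_left]

theorem inner_friction_comm (p q : Conf I) :
    inner ℝ (friction J γ p) q = inner ℝ p (friction J γ q) := by
  rw [real_inner_comm _ p, inner_friction, inner_friction]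
  exact Finset.sum_congr rfl fun j _ => by ring

/-- The linear map `(p, s) ↦ (- Γ p - ω^* s, ω p)`. -/
def linDrift (ω : Conf I →L[ℝ] Conf I) : Phase I →L[ℝ] Phase I :=
  ((WithLp.prodContinuousLinearEquiv 2 ℝ (Conf I) (Conf I)).symm :
      (Conf I × Conf I) →L[ℝ] Phase I) ∘L
    ((-(friction J γ ∘L WithLp.fstL 2 ℝ (Conf I) (Conf I))
      - ContinuousLinearMap.adjoint ω ∘L WithLp.sndL 2 ℝ (Conf I) (Conf I)).prod
      (ω ∘L WithLp.fstL 2 ℝ (Conf I) (Conf I)))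

variable (ω : Conf I →L[ℝ] Conf I)

theorem linDrift_fst (y : Phase I) : (linDrift J γ ω y).fst =
    -(friction J γ y.fst) - ContinuousLinearMap.adjoint ω y.snd := rfl

theorem linDrift_snd (y : Phase I) : (linDrift J γ ω y).snd = ω y.fst := rfl

/-- Friction is symmetric and the coupling skew, so passing to the adjoint only reverses the sign of
`ω`. -/
theorem adjoint_linDrift :
    ContinuousLinearMap.adjoint (linDrift J γ ω) = linDrift J γ (-ω) := by
  symm
  rw [ContinuousLinearMap.eq_adjoint_iff]
  intro x y
  rw [WithLp.prod_inner_apply, WithLp.prod_inner_apply]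
  change inner ℝ (-(friction J γ x.fst) - ContinuousLinearMap.adjoint (-ω) x.snd) y.fst
      + inner ℝ ((-ω) x.fst) y.snd
    = inner ℝ x.fst (-(friction J γ y.fst) - ContinuousLinearMap.adjoint ω y.snd)
      + inner ℝ x.snd (ω y.fst)
  rw [map_neg, inner_sub_left, inner_sub_right, inner_neg_left, inner_neg_right,
    inner_friction_comm, _root_.neg_apply, inner_neg_left,
    ContinuousLinearMap.adjoint_inner_left, _root_.neg_apply, inner_neg_left,
    ContinuousLinearMap.adjoint_inner_right]
  ring

theorem adjoint_controlOp_apply (y : Phase I) (j : J) :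
    ContinuousLinearMap.adjoint (controlOp J) y j = y.fst j := by
  have h : inner ℝ (ContinuousLinearMap.adjoint (controlOp J) y)
      (EuclideanSpace.single j (1 : ℝ)) = y.fst j := by
    rw [ContinuousLinearMap.adjoint_inner_left, WithLp.prod_inner_apply]
    change inner ℝ y.fst ((∑ j : J, iota J j) (EuclideanSpace.single j (1 : ℝ)))
      + inner ℝ y.snd 0 = _
    rw [inner_zero_right, add_zero, _root_.sum_apply, Finset.sum_eq_single j]
    · simp [iota, EuclideanSpace.inner_single_right]
    · intro i _ hij
      simp [iota, EuclideanSpace.inner_single_left, hij]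
    · simp
  simpa [EuclideanSpace.inner_single_right] using h

theorem friction_eq_zero {y : Phase I} (hy : ContinuousLinearMap.adjoint (controlOp J) y = 0) :
    friction J γ y.fst = 0 := by
  rw [friction_apply]
  refine Finset.sum_eq_zero fun j _ => ?_
  rw [← adjoint_controlOp_apply, hy]
  simp

theorem inner_linDrift_self (y : Phase I) :
    inner ℝ (linDrift J γ ω y) y = -∑ j : J, γ j * y.fst j ^ 2 := by
  rw [WithLp.prod_inner_apply]
  change inner ℝ (-(friction J γ y.fst) - ContinuousLinearMap.adjoint ω y.snd) y.fst
    + inner ℝ (ω y.fst) y.snd = _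
  rw [inner_sub_left, inner_neg_left, ContinuousLinearMap.adjoint_inner_left, inner_friction,
    real_inner_comm (ω y.fst) y.snd]
  simp only [pow_two, mul_assoc]
  ring

theorem exists_inner_linDrift_le (hγ : ∀ j, 0 < γ j) : ∃ c : ℝ, 0 < c ∧ ∀ y,
    inner ℝ (linDrift J γ ω y) y ≤ -(c * ‖ContinuousLinearMap.adjoint (controlOp J) y‖ ^ 2) := by
  obtain ⟨c, hc, hcγ⟩ : ∃ c : ℝ, 0 < c ∧ ∀ j, c ≤ γ j := by
    rcases isEmpty_or_nonempty J with h | h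
    · exact ⟨1, one_pos, fun j => h.elim j⟩
    · obtain ⟨i, hi⟩ := Finite.exists_min γ
      exact ⟨γ i, hγ i, hi⟩
  refine ⟨c, hc, fun y => ?_⟩
  rw [inner_linDrift_self, EuclideanSpace.norm_sq_eq, Finset.mul_sum]
  refine neg_le_neg (Finset.sum_le_sum fun j _ => ?_)
  rw [adjoint_controlOp_apply, Real.norm_eq_abs, sq_abs]
  exact mul_le_mul_of_nonneg_right (hcγ j) (sq_nonneg _)

variable {J} {ω}

/-- The Kalman condition for the pair `(ω^* ω, ∑_j ι_j ι_j^*)` makes the momenta at the sites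
of `J` an observable output of the linear network. -/
theorem observable_linDrift (hω : Function.Surjective ω)
    (hK : ControlSystem.Kalman (ContinuousLinearMap.adjoint ω ∘L ω) (bath J)) :
    ControlSystem.Observable (ContinuousLinearMap.adjoint (controlOp J)) (linDrift J γ ω) := by
  set A := linDrift J γ ω
  set C := ContinuousLinearMap.adjoint (controlOp J)
  set W := ContinuousLinearMap.adjoint ω ∘L ω
  -- The unobservable subspace is invariant under `A`, so the facts below can be applied along the
  -- whole orbit.
  have hshift : ∀ y : Phase I, (∀ k : ℕ, C ((A ^ k) y) = 0) → ∀ k : ℕ, C ((A ^ k) (A y)) = 0 :=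
    fun y hy k => by simpa [pow_succ] using hy (k + 1)
  have hfst : ∀ y : Phase I, (∀ k : ℕ, C ((A ^ k) y) = 0) →
      (A y).fst = -ContinuousLinearMap.adjoint ω y.snd := fun y hy => by
    rw [linDrift_fst, friction_eq_zero J γ (y := y) (hy 0), neg_zero, zero_sub]
  have hbath : ∀ m : ℕ, ∀ y : Phase I, (∀ k : ℕ, C ((A ^ k) y) = 0) →
      bath J ((W ^ m) y.fst) = 0 := by
    intro m
    induction m with
    | zero =>
      intro y hy
      rw [bath_eq_friction]
      exact friction_eq_zero J 1 (hy 0)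
    | succ m ih =>
      intro y hy
      have h1 := ih _ (hshift _ (hshift y hy))
      rw [hfst _ (hshift y hy), linDrift_snd, map_neg, map_neg, neg_eq_zero] at h1
      rw [pow_succ]
      exact h1
  have hWs : ∀ m : ℕ, ∀ x z : Conf I, inner ℝ ((W ^ m) x) z = inner ℝ x ((W ^ m) z) := by
    have h1 : ∀ x z : Conf I, inner ℝ (W x) z = inner ℝ x (W z) := fun x z => by
      change inner ℝ (ContinuousLinearMap.adjoint ω (ω x)) z
        = inner ℝ x (ContinuousLinearMap.adjoint ω (ω z))
      rw [ContinuousLinearMap.adjoint_inner_left, ContinuousLinearMap.adjoint_inner_right]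
    intro m
    induction m with
    | zero => intro x z; rfl
    | succ m ih =>
      intro x z
      rw [pow_succ, mul_apply_eq_comp, ih, h1, ← mul_apply_eq_comp,
        ← pow_succ', pow_succ]
  -- Expand one copy of `y.fst` by Kalman and move the symmetric `W ^ k` and `bath J` onto the
  -- other, where `hbath` kills each term.
  have hzero : ∀ y : Phase I, (∀ k : ℕ, C ((A ^ k) y) = 0) → y.fst = 0 := by
    intro y hy
    obtain ⟨z, hz⟩ := hK y.fst
    rw [← inner_self_eq_zero (𝕜 := ℝ)]
    nth_rw 2 [hz]
    rw [inner_sum]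
    refine Finset.sum_eq_zero fun k _ => ?_
    rw [← hWs, bath_eq_friction, ← inner_friction_comm, ← bath_eq_friction, hbath _ y hy,
      inner_zero_left]
  intro y hy
  have h1 : ContinuousLinearMap.adjoint ω y.snd = 0 := by
    rw [← neg_eq_zero, ← hfst y hy]
    exact hzero _ (hshift y hy)
  have h2 : y.snd = 0 := by
    obtain ⟨x, hx⟩ := hω y.snd
    rw [← inner_self_eq_zero (𝕜 := ℝ)]
    nth_rw 2 [← hx]
    rw [← ContinuousLinearMap.adjoint_inner_left, h1, inner_zero_left]
  have h3 := hzero y hy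
  rw [← WithLp.toLp_ofLp 2 y]
  exact congrArg (WithLp.toLp 2) (Prod.ext h3 h2)

variable {γ}

/-! ### The nonlinear drift -/

variable {U : Conf I → ℝ} {ω : Conf I ≃L[ℝ] Conf I}

theorem drift_eq (y : Phase I) : drift J γ ω U y =
    linDrift J γ (ω : Conf I →L[ℝ] Conf I) y
      + WithLp.toLp 2 (-gradient U (ω.symm y.snd), 0) := by
  change WithLp.toLp 2 _ = WithLp.toLp 2 (_, _)
  congr 1
  refine Prod.ext ?_ ?_
  · exact sub_eq_add_neg _ _
  · exact (add_zero _).symm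

theorem exists_lipschitzWith_drift (hG : CondG U) : ∃ K, LipschitzWith K (drift J γ ω U) := by
  obtain ⟨L, hL⟩ := hG.lipschitz
  have h1 : LipschitzWith (L * ‖(ω.symm : Conf I →L[ℝ] Conf I)‖₊)
      fun y : Phase I => (WithLp.toLp 2 (-gradient U (ω.symm y.snd), 0) : Phase I) := by
    refine LipschitzWith.of_dist_le_mul fun x y => ?_
    rw [dist_eq_norm, ← WithLp.toLp_sub, Prod.mk_sub_mk, sub_self, WithLp.norm_toLp_fst, neg_sub_neg,
      norm_sub_rev, NNReal.coe_mul, coe_nnnorm, mul_assoc, ← dist_eq_norm]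
    refine (hL.dist_le_mul _ _).trans ?_
    gcongr
    rw [dist_eq_norm, ← map_sub, dist_eq_norm]
    refine ((ω.symm : Conf I →L[ℝ] Conf I).le_opNorm _).trans ?_
    gcongr
    exact WithLp.norm_snd_le (x := x - y) ..
  have h2 := (linDrift J γ (ω : Conf I →L[ℝ] Conf I)).lipschitz.add h1
  exact ⟨_, by simpa only [← drift_eq] using h2⟩

theorem exists_norm_drift_sub_le (hG : CondG U) {δ : ℝ} (hδ : 0 < δ) :
    ∃ C : ℝ, ∀ y, ‖drift J γ ω U y - linDrift J γ (ω : Conf I →L[ℝ] Conf I) y‖ ≤ δ * ‖y‖ + C := by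
  set m := ‖(ω.symm : Conf I →L[ℝ] Conf I)‖ + 1
  have hm : 0 < m := by positivity
  obtain ⟨C, hC⟩ := hG.exists_norm_gradient_le (div_pos hδ hm)
  refine ⟨C, fun y => ?_⟩
  rw [drift_eq, add_sub_cancel_left, WithLp.norm_toLp_fst, norm_neg]
  refine (hC _).trans ?_
  have h1 : ‖ω.symm y.snd‖ ≤ m * ‖y‖ := by
    refine ((ω.symm : Conf I →L[ℝ] Conf I).le_opNorm _).trans ?_
    exact mul_le_mul (le_add_of_nonneg_right zero_le_one) (WithLp.norm_snd_le (x := y) ..) (norm_nonneg _) hm.le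
  have h2 := mul_le_mul_of_nonneg_left h1 (div_pos hδ hm).le
  rw [← mul_assoc, div_mul_cancel₀ _ hm.ne'] at h2
  linarith

end Network

end

/-- The growth condition alone makes the force sublinear, hence a perturbation which Brouwer's
theorem absorbs: every point is reached exactly, and (C2), (C3) hold at every `xhat`. The decay of
the derivatives of `U` along a sequence is therefore not used. -/
theorem mainTheorem8 {I : Type*} [Fintype I] [DecidableEq I]
    (J : Finset I) (hJ : J.Nonempty)
    (ω : Network.Conf I ≃L[ℝ] Network.Conf I)
    (γ : J → ℝ) (hγ : ∀ j, 0 < γ j)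
    (U : Network.Conf I → ℝ)
    (hK : Network.CondK J ω) (hG : Network.CondG U) (hpH : Network.CondPH U) :
    ControlSystem.WellPosed (Network.drift J γ ω U) (Network.controlOp J) ∧
    (∃ b : LinearMap.BilinForm ℝ (Network.Phase I), ControlSystem.IsScalarProduct b ∧
      ControlSystem.Dissipative b (Network.drift J γ ω U)) ∧
    ∃ xhat : Network.Phase I,
      ControlSystem.ApproxControllableTo (Network.drift J γ ω U) (Network.controlOp J) xhat ∧
      ControlSystem.SolidlyControllableFrom (Network.drift J γ ω U) (Network.controlOp J) xhat := by
  obtain ⟨K, hf⟩ := Network.exists_lipschitzWith_drift (J := J) (γ := γ) (ω := ω) hG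
  have hsub : ∀ δ : ℝ, 0 < δ → ∃ C : ℝ, ∀ y, ‖Network.drift J γ ω U y
      - Network.linDrift J γ (ω : Network.Conf I →L[ℝ] Network.Conf I) y‖ ≤ δ * ‖y‖ + C :=
    fun δ hδ => Network.exists_norm_drift_sub_le hG hδ
  have hobs := Network.observable_linDrift γ ω.surjective hK
  have hobs' : ControlSystem.Observable (ContinuousLinearMap.adjoint (Network.controlOp J))
      (ContinuousLinearMap.adjoint
        (Network.linDrift J γ (ω : Network.Conf I →L[ℝ] Network.Conf I))) := by
    -- The dual network has coupling `-ω`, with the same `ω^* ω` and hence the same Kalman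
    -- condition.
    rw [Network.adjoint_linDrift]
    refine Network.observable_linDrift γ (fun x => ⟨-ω.symm x, by simp⟩) ?_
    have h : ContinuousLinearMap.adjoint (-(ω : Network.Conf I →L[ℝ] Network.Conf I))
          ∘L (-(ω : Network.Conf I →L[ℝ] Network.Conf I))
        = ContinuousLinearMap.adjoint (ω : Network.Conf I →L[ℝ] Network.Conf I)
          ∘L (ω : Network.Conf I →L[ℝ] Network.Conf I) := by
      rw [map_neg, ContinuousLinearMap.neg_comp, ContinuousLinearMap.comp_neg, neg_neg]
    rw [h]
    exact hK
  obtain ⟨c, hc, hA⟩ := Network.exists_inner_linDrift_le J γ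
    (ω : Network.Conf I →L[ℝ] Network.Conf I) hγ
  exact ⟨ControlSystem.wellPosed_of_lipschitzWith hf _,
    ControlSystem.exists_dissipative_of_sublinear hobs hc hA hsub, 0,
    ControlSystem.approxControllableTo_of_sublinear hf hobs' hsub 0,
    ControlSystem.solidlyControllableFrom_of_sublinear hf hobs' hsub 0⟩
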